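/- Let $\mathcal D\subset L^2(\mathbb R^2)$ be the space of functions $q(x,y)e^{-(x^2+y^2)}$ with $q$ a complex polynomial, and let $$a=x+\tfrac12\partial_x,\quad a^*=x-\tfrac12\partial_x,\quad b=y+\tfrac12\partial_y,\quad b^*=y-\tfrac12\partial_y,$$ acting on Schwartz functions; $a^*,b^*$ are the formal adjoints of $a,b$, and $[a,a^*]=[b,b^*]=1$, while $a$, $a^*$ commute with $b$, $b^*$. Let $\beta,\gamma\in\mathbb R$ with $\gamma\neq0$, put $\rho=\sqrt{1+\gamma^2}$, and let $$H=a^*a+bb^*+\beta(a^*a-b^*b)+\gamma(a^*b^*-ab)$$ be defined on $\mathcal D$. Then $\mathcal D$ is dense in $L^2(\mathbb R^2)$ and $H$ is closable; denote its closure again by $H$ and the Hilbert space adjoint by $H^*$. Let $$\mathcal N=(2\gamma\rho)^{-1/2}\in\mathbb C,\qquad c=\mathcal N((\rho-1)b^*+\gamma a),\quad d=\mathcal N((\rho-1)a^*+\gamma b),$$ $$c^\ddag=\mathcal N((1+\rho)a^*-\gamma b),\quad d^\ddag=\mathcal N((1+\rho)b^*-\gamma a)$$ (principal branch of the power), let $c^*,d^*,c^{\ddag*},d^{\ddag*}$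 be their formal adjoints, $\Phi_0=e^{-(x^2+y^2)}$, $\alpha=\gamma/(1+\rho)$, and $$\Psi_0=(1-\alpha^2)^{-1/2}\exp\Big(-\tfrac{1+\alpha^2}{1-\alpha^2}(x^2+y^2)-\tfrac{4\alpha}{1-\alpha^2}xy\Big),\qquad \Psi_0'=(1-\alpha^2)^{-1/2}\exp\Big(-\tfrac{1+\alpha^2}{1-\alpha^2}(x^2+y^2)+\tfrac{4\alpha}{1-\alpha^2}xy\Big).$$ For $m,n\ge0$ put $\Psi_{m,n}=c^{\ddag m}d^{\ddag n}\Psi_0$, $\Psi'_{m,n}=c^{*m}d^{*n}\Psi'_0$ and $$E_{m,n}=\rho+m(\beta+\rho)+n(-\beta+\rho).$$ Then the following hold. 1. (Pseudo-bosons.) $[c,c^\ddag]=[d,d^\ddag]=1$, the remaining commutators of $c,d,c^\ddag,d^\ddag$ vanish, $c^\ddag\ne c^*$, $d^\ddag\neq d^*$, and, on Schwartz functions, $H$ acts as $\beta(c^\ddag c-d^\ddag d)+\rho(c^\ddag c+dd^\ddag)$. Moreover $\Psi_0=\exp(-\alpha a^*b^*)\Phi_0$ and $\Psi_0'=\exp(\alpha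 a^*b^*)\Phi_0$ (exponential series converging in $L^2$), $c\Psi_0=d\Psi_0=0$ and $c^{\ddag*}\Psi_0'=d^{\ddag*}\Psi_0'=0$. 2. The set of eigenvalues of $H$ is $\{E_{m,n}:m,n\ge0\}$, $\Psi_{m,n}$ is an eigenvector of $H$ for $E_{m,n}$, and the system $(\Psi_{m,n})$ is complete (its linear span is dense). 3. $H^*$ has the same set of eigenvalues, $\Psi'_{m,n}$ is an eigenvector of $H^*$ for $E_{m,n}$, and the system $(\Psi'_{m,n})$ is complete. 4. $\langle\Psi_{m,n},\Psi'_{p,q}\rangle=m!\,n!\,\delta_{mp}\delta_{nq}\langle\Psi_0,\Psi_0'\rangle$, and $\langle\Psi_0,\Psi'_0\rangle\ne0$. 5. There is a unitary operator $S=\exp\big(-i\tfrac\pi2(a^*a+b^*b)\big)$ on $L^2(\mathbb R^2)$ (given on $\mathcal D$ by the convergent exponential series) such that $SaS^{-1}=ia$ and $SbS^{-1}=ib$ as operators with domain $\mathcal D$, and $H^*=SHS^{-1}$, including equality of domains. In particular $H$ belongs to the class $\mathcal C$ of densely defined, closed, unbounded operators on a Hilbert space such that: (I) $H$ is not self-adjoint;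 (II) $H$ has eigenvalues and they are all real; (III) $H$ and $H^*$ have the same eigenvalues and the same spectrum; (IV) there are complete biorthogonal systems of eigenvectors $v_i$ of $H$ and $w_i$ of $H^*$, for the same real eigenvalues (where biorthogonal means $\langle v_i,w_j\rangle=0$ if and only if $i\ne j$); (V) $H^*=SHS^{-1}$ for some unitary $S$. -/

import Mathlib

open MeasureTheory

noncomputable section

namespace PseudoBoson

/-! ### Unbounded operators on a Hilbert space -/

section Abstract

variable {E : Type*} [NormedAddCommGroup E] [InnerProductSpace ℂ E]

/-- `v` is an eigenvector of the (partially defined) operator `T` for the eigenvalue `z`. -/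
def IsEigenvector (T : E →ₗ.[ℂ] E) (z : ℂ) (v : E) : Prop :=
  v ≠ 0 ∧ (v, z • v) ∈ T.graph

/-- The set of eigenvalues of `T`. -/
def eigenvalues (T : E →ₗ.[ℂ] E) : Set ℂ :=
  {z | ∃ v, IsEigenvector T z v}

/-- The spectrum of `T`: those `z` for which `T - z` has no bounded everywhere defined inverse. -/
def opSpectrum (T : E →ₗ.[ℂ] E) : Set ℂ :=
  {z | ¬ ∃ R : E →L[ℂ] E,
    (∀ f, (R f, f + z • R f) ∈ T.graph) ∧ ∀ x : T.domain, R (T x - z • (x : E)) = x}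

/-- A family of vectors is complete if the closed linear span is everything, i.e. if `0` is the
only vector orthogonal to the whole family. -/
def IsCompleteSystem {ι : Type*} (v : ι → E) : Prop :=
  (Submodule.span ℂ (Set.range v)).topologicalClosure = ⊤

/-- Two families are biorthogonal if `⟪v i, w j⟫` vanishes exactly for `i ≠ j`. -/
def IsBiorthogonal {ι : Type*} (v w : ι → E) : Prop :=
  ∀ i j, inner ℂ (v i) (w j) = 0 ↔ i ≠ j

/-- The operator `S T S⁻¹`, with domain `S (dom T)`, for a unitary `S`. -/
def unitaryConj (S : E ≃ₗᵢ[ℂ] E) (T : E →ₗ.[ℂ] E) : E →ₗ.[ℂ] E where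
  domain := T.domain.comap S.symm.toLinearEquiv.toLinearMap
  toFun := S.toLinearEquiv.toLinearMap ∘ₗ T.toFun ∘ₗ
    S.symm.toLinearEquiv.toLinearMap.restrict (fun _ hf => hf)

theorem mem_graph_unitaryConj (S : E ≃ₗᵢ[ℂ] E) (T : E →ₗ.[ℂ] E) (f g : E) :
    (f, g) ∈ (unitaryConj S T).graph ↔ (S.symm f, S.symm g) ∈ T.graph := by
  simp only [LinearPMap.mem_graph_iff]
  constructor
  · rintro ⟨⟨y, hy⟩, h1, h2⟩
    refine ⟨⟨S.symm y, hy⟩, ?_, ?_⟩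
    · simpa using h1
    · rw [← h2]
      exact (S.symm_apply_apply _).symm
  · rintro ⟨⟨y, hy⟩, h1, h2⟩
    simp only at h1 h2
    subst h1
    refine ⟨⟨f, hy⟩, rfl, ?_⟩
    have h3 : S (T ⟨S.symm f, hy⟩) = g := by rw [h2, S.apply_symm_apply]
    exact h3

/-- The class of unbounded, densely defined closed operators `H` on a Hilbert space with the
properties (I) to (V): non self-adjoint; real eigenvalues; `H` and its adjoint are isospectral;
eigenvectors of `H` and of its adjoint form complete biorthogonal systems; `H` is unitarily
equivalent to its adjoint. -/
structure ClassC [CompleteSpace E] (H : E →ₗ.[ℂ] E) : Prop where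
  dense_domain : Dense (H.domain : Set E)
  closed : H.IsClosed
  unbounded : ¬ ∃ C : ℝ, ∀ f : H.domain, ‖H f‖ ≤ C * ‖(f : E)‖
  not_selfAdjoint : ¬ IsSelfAdjoint H
  eigenvalues_nonempty : (eigenvalues H).Nonempty
  eigenvalues_real : ∀ z ∈ eigenvalues H, z.im = 0
  eigenvalues_adjoint : eigenvalues H.adjoint = eigenvalues H
  spectrum_adjoint : opSpectrum H.adjoint = opSpectrum H
  biorthogonal : ∃ (ι : Type) (e : ι → ℝ) (v w : ι → E),
    (∀ i, IsEigenvector H (e i) (v i)) ∧ (∀ i, IsEigenvector H.adjoint (e i) (w i)) ∧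
    IsCompleteSystem v ∧ IsCompleteSystem w ∧ IsBiorthogonal v w
  unitarily_equivalent : ∃ S : E ≃ₗᵢ[ℂ] E, H.adjoint = unitaryConj S H

end Abstract

/-! ### The bosonic operators, as operators on Schwartz functions of two variables -/

/-- Schwartz functions on the plane. -/
abbrev Sch : Type := SchwartzMap (ℝ × ℝ) ℂ

/-- Linear operators on Schwartz functions. -/
abbrev Op : Type := Module.End ℂ Sch

/-- The Hilbert space `L²(ℝ²)`. -/
abbrev L2 : Type := Lp ℂ 2 (volume : Measure (ℝ × ℝ))

/-- The inclusion of the Schwartz functions in `L²(ℝ²)`. -/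
def toL2 : Sch →ₗ[ℂ] L2 := (SchwartzMap.toLpCLM ℂ ℂ 2 volume).toLinearMap

theorem toL2_injective : Function.Injective toL2 :=
  SchwartzMap.injective_toLp 2 volume

/-- Multiplication by the first coordinate. -/
def mulX : Op := (SchwartzMap.smulLeftCLM ℂ (fun p : ℝ × ℝ => (p.1 : ℂ))).toLinearMap

/-- Multiplication by the second coordinate. -/
def mulY : Op := (SchwartzMap.smulLeftCLM ℂ (fun p : ℝ × ℝ => (p.2 : ℂ))).toLinearMap

/-- The partial derivative in the first coordinate. -/
def derivX : Op := (LineDeriv.lineDerivOpCLM ℂ Sch ((1, 0) : ℝ × ℝ)).toLinearMap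

/-- The partial derivative in the second coordinate. -/
def derivY : Op := (LineDeriv.lineDerivOpCLM ℂ Sch ((0, 1) : ℝ × ℝ)).toLinearMap

/-- The annihilation operator `a = x + (1/2) ∂/∂x`. -/
def opA : Op := mulX + (1 / 2 : ℂ) • derivX

/-- The creation operator `a* = x - (1/2) ∂/∂x`. -/
def opAs : Op := mulX - (1 / 2 : ℂ) • derivX

/-- The annihilation operator `b = y + (1/2) ∂/∂y`. -/
def opB : Op := mulY + (1 / 2 : ℂ) • derivY

/-- The creation operator `b* = y - (1/2) ∂/∂y`. -/
def opBs : Op := mulY - (1 / 2 : ℂ) • derivY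

theorem mulX_apply (f : Sch) (p : ℝ × ℝ) : mulX f p = (p.1 : ℂ) * f p := by
  have h : Function.HasTemperateGrowth (fun p : ℝ × ℝ => (p.1 : ℂ)) :=
    (Complex.ofRealCLM.comp (ContinuousLinearMap.fst ℝ ℝ ℝ)).hasTemperateGrowth
  exact SchwartzMap.smulLeftCLM_apply_apply h f p

theorem mulY_apply (f : Sch) (p : ℝ × ℝ) : mulY f p = (p.2 : ℂ) * f p := by
  have h : Function.HasTemperateGrowth (fun p : ℝ × ℝ => (p.2 : ℂ)) :=
    (Complex.ofRealCLM.comp (ContinuousLinearMap.snd ℝ ℝ ℝ)).hasTemperateGrowth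
  exact SchwartzMap.smulLeftCLM_apply_apply h f p

theorem opA_apply (f : Sch) (p : ℝ × ℝ) :
    opA f p = (p.1 : ℂ) * f p + (1 / 2 : ℂ) * lineDeriv ℝ f p (1, 0) := by
  rw [← SchwartzMap.lineDerivOp_apply, ← mulX_apply]
  rfl

theorem opAs_apply (f : Sch) (p : ℝ × ℝ) :
    opAs f p = (p.1 : ℂ) * f p - (1 / 2 : ℂ) * lineDeriv ℝ f p (1, 0) := by
  rw [← SchwartzMap.lineDerivOp_apply, ← mulX_apply]
  rfl

theorem opB_apply (f : Sch) (p : ℝ × ℝ) :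
    opB f p = (p.2 : ℂ) * f p + (1 / 2 : ℂ) * lineDeriv ℝ f p (0, 1) := by
  rw [← SchwartzMap.lineDerivOp_apply, ← mulY_apply]
  rfl

theorem opBs_apply (f : Sch) (p : ℝ × ℝ) :
    opBs f p = (p.2 : ℂ) * f p - (1 / 2 : ℂ) * lineDeriv ℝ f p (0, 1) := by
  rw [← SchwartzMap.lineDerivOp_apply, ← mulY_apply]
  rfl

/-- `T'` is a formal adjoint of `T`: `⟪T f, g⟫ = ⟪f, T' g⟫` for all Schwartz functions. -/
def IsFormalAdjoint (T T' : Op) : Prop :=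
  ∀ f g : Sch, inner ℂ (toL2 (T f)) (toL2 g) = inner ℂ (toL2 f) (toL2 (T' g))

/-- The domain `𝒟` of Gaussian times polynomial functions. -/
def gaussPoly : Submodule ℂ Sch where
  carrier := {f | ∃ q : MvPolynomial (Fin 2) ℂ, ∀ x y : ℝ,
    f (x, y) = MvPolynomial.eval ![(x : ℂ), (y : ℂ)] q * (Real.exp (-(x ^ 2 + y ^ 2)) : ℂ)}
  add_mem' := by
    rintro f g ⟨q, hq⟩ ⟨r, hr⟩
    refine ⟨q + r, fun x y => ?_⟩
    rw [add_apply, hq, hr, map_add, add_mul]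
  zero_mem' := ⟨0, fun x y => by simp⟩
  smul_mem' := by
    rintro c f ⟨q, hq⟩
    refine ⟨MvPolynomial.C c * q, fun x y => ?_⟩
    rw [smul_apply, hq, map_mul, MvPolynomial.eval_C, smul_eq_mul, mul_assoc]

/-- The operator `T` on `L²(ℝ²)` with domain `𝒟`. -/
def onGaussPoly (T : Op) : L2 →ₗ.[ℂ] L2 where
  domain := gaussPoly.map toL2
  toFun := toL2 ∘ₗ T ∘ₗ gaussPoly.subtype ∘ₗ
    (Submodule.equivMapOfInjective toL2 toL2_injective gaussPoly).symm.toLinearMap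

theorem mem_graph_onGaussPoly (T : Op) (u v : L2) :
    (u, v) ∈ (onGaussPoly T).graph ↔ ∃ f ∈ gaussPoly, toL2 f = u ∧ toL2 (T f) = v := by
  rw [LinearPMap.mem_graph_iff]
  set e := Submodule.equivMapOfInjective toL2 toL2_injective gaussPoly with he
  have key : ∀ y : gaussPoly.map toL2, (onGaussPoly T) y = toL2 (T (e.symm y : Sch)) :=
    fun y => rfl
  constructor
  · rintro ⟨y, h1, h2⟩
    refine ⟨(e.symm y : Sch), (e.symm y).2, ?_, ?_⟩
    · exact (Submodule.map_equivMapOfInjective_symm_apply toL2 toL2_injective gaussPoly y).trans h1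
    · exact (key y).symm.trans h2
  · rintro ⟨f, hf, h1, h2⟩
    refine ⟨e ⟨f, hf⟩, ?_, ?_⟩
    · rw [← h1]
      rfl
    · rw [← h2]
      refine (key (e ⟨f, hf⟩)).trans ?_
      rw [e.symm_apply_apply]

/-- `U = exp (z T)` for an operator `T` on `𝒟`: the exponential series converges to `U f` for
every `f ∈ 𝒟`. As `𝒟` is dense, this determines a bounded operator `U` uniquely. -/
def IsExp (z : ℂ) (T : Op) (U : L2 → L2) : Prop :=
  ∀ f ∈ gaussPoly,
    HasSum (fun k : ℕ => (z ^ k / (k.factorial : ℂ)) • toL2 ((T ^ k) f)) (U (toL2 f))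

/-! ### Gaussians -/

theorem norm_iteratedDeriv_exp (i : ℕ) (t : ℝ) : ‖iteratedFDeriv ℝ i Real.exp t‖ = Real.exp t := by
  rw [norm_iteratedFDeriv_eq_norm_iteratedDeriv, iteratedDeriv_eq_iterate,
    Real.iter_deriv_exp, Real.norm_eq_abs, abs_of_pos (Real.exp_pos t)]

theorem exp_neg_decay (k n : ℕ) (δ : ℝ) (hδ : 0 < δ) :
    ∃ C : ℝ, ∀ r : ℝ, 0 ≤ r → r ^ k * ((1 + r) ^ n * Real.exp (-(δ * r ^ 2))) ≤ C := by
  have h1 : ∀ r : ℝ, 0 ≤ r → (1 + r) ^ (k + n) ≤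
      ((k + n).factorial : ℝ) * Real.exp (1 + r) := by
    intro r hr
    have h := Real.pow_div_factorial_le_exp (1 + r) (by linarith) (k + n)
    rwa [div_le_iff₀ (by positivity), mul_comm] at h
  refine ⟨((k + n).factorial : ℝ) * Real.exp (1 + 1 / (4 * δ)), fun r hr => ?_⟩
  have h2 : r ^ k * (1 + r) ^ n ≤ (1 + r) ^ (k + n) := by
    rw [pow_add]
    gcongr
    linarith
  have h3 : 1 + r + -(δ * r ^ 2) ≤ 1 + 1 / (4 * δ) := by
    have h4 : 1 / (4 * δ) - r + δ * r ^ 2 = δ * (r - 1 / (2 * δ)) ^ 2 := by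
      field_simp
      ring
    nlinarith [mul_nonneg hδ.le (sq_nonneg (r - 1 / (2 * δ)))]
  calc r ^ k * ((1 + r) ^ n * Real.exp (-(δ * r ^ 2)))
      = (r ^ k * (1 + r) ^ n) * Real.exp (-(δ * r ^ 2)) := by ring
    _ ≤ (((k + n).factorial : ℝ) * Real.exp (1 + r)) * Real.exp (-(δ * r ^ 2)) := by
        exact mul_le_mul_of_nonneg_right (h2.trans (h1 r hr)) (Real.exp_pos _).le
    _ = ((k + n).factorial : ℝ) * Real.exp (1 + r + -(δ * r ^ 2)) := by
        rw [Real.exp_add (1 + r)]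
        ring
    _ ≤ _ := by gcongr

/-- The exponential of a coercive quadratic form is a Schwartz function. -/
def expNegReal (Q : ℝ × ℝ → ℝ) (hQ : Q.HasTemperateGrowth) (δ : ℝ) (hδ : 0 < δ)
    (h : ∀ p, δ * ‖p‖ ^ 2 ≤ -Q p) : SchwartzMap (ℝ × ℝ) ℝ where
  toFun := Real.exp ∘ Q
  smooth' := Real.contDiff_exp.comp hQ.1
  decay' := by
    intro k n
    obtain ⟨l, C, hC, hb⟩ := hQ.norm_iteratedFDeriv_le_uniform n
    obtain ⟨M, hM⟩ := exp_neg_decay k (l * n) δ hδ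
    refine ⟨(n.factorial : ℝ) * (C + 1) ^ n * M, fun p => ?_⟩
    have h1 := norm_iteratedFDeriv_comp_le (𝕜 := ℝ) (g := Real.exp) (f := Q) (n := n) (N := n)
      Real.contDiff_exp (hQ.1.of_le (by exact_mod_cast le_top)) le_rfl p
      (C := Real.exp (Q p)) (D := (C + 1) * (1 + ‖p‖) ^ l)
      (fun i _ => (norm_iteratedDeriv_exp i (Q p)).le)
      (fun i hi hin => by
        refine (hb i hin p).trans ?_
        have h2 : (1 : ℝ) ≤ (C + 1) * (1 + ‖p‖) ^ l :=
          one_le_mul_of_one_le_of_one_le (by linarith)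
            (one_le_pow₀ (by linarith [norm_nonneg p]))
        calc C * (1 + ‖p‖) ^ l ≤ (C + 1) * (1 + ‖p‖) ^ l := by gcongr; linarith
          _ ≤ _ := le_self_pow₀ h2 (by omega))
    have h3 : Real.exp (Q p) ≤ Real.exp (-(δ * ‖p‖ ^ 2)) :=
      Real.exp_le_exp.2 (by linarith [h p])
    calc ‖p‖ ^ k * ‖iteratedFDeriv ℝ n (Real.exp ∘ Q) p‖
        ≤ ‖p‖ ^ k * ((n.factorial : ℝ) * Real.exp (-(δ * ‖p‖ ^ 2)) *
            ((C + 1) * (1 + ‖p‖) ^ l) ^ n) := by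
          gcongr
          exact h1.trans (by gcongr)
      _ = (n.factorial : ℝ) * (C + 1) ^ n *
          (‖p‖ ^ k * ((1 + ‖p‖) ^ (l * n) * Real.exp (-(δ * ‖p‖ ^ 2)))) := by
          rw [mul_pow, ← pow_mul]
          ring
      _ ≤ _ := by
          gcongr
          exact hM _ (norm_nonneg p)

/-- The exponent of the Gaussian `exp (-α a* b*) Φ₀`. -/
def quadForm (α : ℝ) (p : ℝ × ℝ) : ℝ :=
  -((1 + α ^ 2) / (1 - α ^ 2)) * (p.1 ^ 2 + p.2 ^ 2) - 4 * α / (1 - α ^ 2) * (p.1 * p.2)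

theorem quadForm_temperate (α : ℝ) : (quadForm α).HasTemperateGrowth := by
  have h1 : Function.HasTemperateGrowth (fun p : ℝ × ℝ => p.1) :=
    (ContinuousLinearMap.fst ℝ ℝ ℝ).hasTemperateGrowth
  have h2 : Function.HasTemperateGrowth (fun p : ℝ × ℝ => p.2) :=
    (ContinuousLinearMap.snd ℝ ℝ ℝ).hasTemperateGrowth
  have hc : ∀ c : ℝ, Function.HasTemperateGrowth (fun _ : ℝ × ℝ => c) :=
    fun c => Function.HasTemperateGrowth.const c
  exact ((hc _).mul ((h1.pow 2).add (h2.pow 2))).sub ((hc _).mul (h1.mul h2))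

theorem quadForm_coercive {α : ℝ} (hα : |α| < 1) (p : ℝ × ℝ) :
    (1 - |α|) ^ 2 / (1 - α ^ 2) * ‖p‖ ^ 2 ≤ -quadForm α p := by
  have hpos : 0 < 1 - α ^ 2 := by
    have := (sq_lt_one_iff_abs_lt_one α).2 hα
    linarith
  have hn : ‖p‖ ^ 2 ≤ p.1 ^ 2 + p.2 ^ 2 := by
    rw [Prod.norm_def]
    rcases max_choice ‖p.1‖ ‖p.2‖ with h | h <;>
      rw [h, Real.norm_eq_abs, sq_abs] <;> nlinarith [sq_nonneg p.1, sq_nonneg p.2]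
  have hxy : 2 * |p.1 * p.2| ≤ p.1 ^ 2 + p.2 ^ 2 := by
    rw [abs_mul]
    nlinarith [sq_nonneg (|p.1| - |p.2|), sq_abs p.1, sq_abs p.2]
  have hb : -(α * (p.1 * p.2)) ≤ |α| * |p.1 * p.2| := by
    rw [← abs_mul]
    exact neg_le_abs _
  have hmain : (1 - |α|) ^ 2 * ‖p‖ ^ 2 ≤
      (1 + α ^ 2) * (p.1 ^ 2 + p.2 ^ 2) + 4 * α * (p.1 * p.2) := by
    have h1 : (1 - |α|) ^ 2 * ‖p‖ ^ 2 ≤ (1 - |α|) ^ 2 * (p.1 ^ 2 + p.2 ^ 2) := by gcongr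
    have h2 : |α| * (2 * |p.1 * p.2|) ≤ |α| * (p.1 ^ 2 + p.2 ^ 2) := by gcongr
    have h3 : -(4 * α * (p.1 * p.2)) ≤ 2 * (|α| * (p.1 ^ 2 + p.2 ^ 2)) := by
      have h4 : -(α * (p.1 * p.2)) ≤ |α| * |p.1 * p.2| := hb
      nlinarith
    have h5 : (1 - |α|) ^ 2 = 1 + α ^ 2 - 2 * |α| := by
      rw [← sq_abs α]
      ring
    rw [h5] at h1 ⊢
    nlinarith
  have : -quadForm α p =
      ((1 + α ^ 2) * (p.1 ^ 2 + p.2 ^ 2) + 4 * α * (p.1 * p.2)) / (1 - α ^ 2) := by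
    unfold quadForm
    field_simp
    ring
  rw [this, div_mul_eq_mul_div]
  gcongr

/-- The function `(1-α²)^(-1/2) exp (-(1+α²)/(1-α²) (x²+y²) - 4α/(1-α²) xy)`, for `|α| < 1`. -/
def squeezed (α : ℝ) (hα : |α| < 1) : Sch :=
  ((Real.sqrt (1 - α ^ 2))⁻¹ : ℂ) •
    SchwartzMap.postcompCLM Complex.ofRealCLM
      (expNegReal (quadForm α) (quadForm_temperate α) ((1 - |α|) ^ 2 / (1 - α ^ 2))
        (by
          have h1 := (sq_lt_one_iff_abs_lt_one α).2 hα
          have h2 : 0 < 1 - |α| := by linarith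
          have h3 : 0 < 1 - α ^ 2 := by linarith
          positivity)
        (quadForm_coercive hα))

theorem squeezed_apply (α : ℝ) (hα : |α| < 1) (x y : ℝ) :
    squeezed α hα (x, y) = (((Real.sqrt (1 - α ^ 2))⁻¹ *
      Real.exp (-((1 + α ^ 2) / (1 - α ^ 2)) * (x ^ 2 + y ^ 2)
        - 4 * α / (1 - α ^ 2) * (x * y)) : ℝ) : ℂ) := by
  rw [Complex.ofReal_mul, Complex.ofReal_inv]
  rfl

/-- The vacuum `Φ₀ = exp (-(x² + y²))`. -/
def vacuum : Sch := squeezed 0 (by simp)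

theorem vacuum_apply (x y : ℝ) : vacuum (x, y) = (Real.exp (-(x ^ 2 + y ^ 2)) : ℂ) := by
  rw [vacuum, squeezed_apply]
  simp

/-! ### The Hamiltonian and its pseudo-bosons -/

/-- The Hamiltonian `a*a + bb* + β (a*a - b*b) + γ (a*b* - ab)`. -/
def hamOp (β γ : ℝ) : Op :=
  opAs * opA + opB * opBs + (β : ℂ) • (opAs * opA - opBs * opB)
    + (γ : ℂ) • (opAs * opBs - opA * opB)

/-- The Hamiltonian as a closed operator: the closure of `hamOp` with domain `𝒟`. -/
def ham (β γ : ℝ) : L2 →ₗ.[ℂ] L2 := (onGaussPoly (hamOp β γ)).closure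

/-- `√(1+γ²)`. -/
def rho (γ : ℝ) : ℝ := Real.sqrt (1 + γ ^ 2)

/-- The normalization constant `(2 γ √(1+γ²))^(-1/2)`, complex (principal branch) if `γ < 0`. -/
def normConst (γ : ℝ) : ℂ := ((2 * γ * rho γ : ℝ) : ℂ) ^ (-(1 / 2) : ℂ)

/-- `c = 𝒩 ((-1+√(1+γ²)) b* + γ a)`. -/
def opC (γ : ℝ) : Op := normConst γ • (((-1 + rho γ : ℝ) : ℂ) • opBs + (γ : ℂ) • opA)

/-- `d = 𝒩 ((-1+√(1+γ²)) a* + γ b)`. -/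
def opD (γ : ℝ) : Op := normConst γ • (((-1 + rho γ : ℝ) : ℂ) • opAs + (γ : ℂ) • opB)

/-- `c^‡ = 𝒩 ((1+√(1+γ²)) a* - γ b)`. -/
def opCd (γ : ℝ) : Op := normConst γ • (((1 + rho γ : ℝ) : ℂ) • opAs - (γ : ℂ) • opB)

/-- `d^‡ = 𝒩 ((1+√(1+γ²)) b* - γ a)`. -/
def opDd (γ : ℝ) : Op := normConst γ • (((1 + rho γ : ℝ) : ℂ) • opBs - (γ : ℂ) • opA)

/-- The adjoint `c*` of `c`. -/
def opCs (γ : ℝ) : Op :=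
  star (normConst γ) • (((-1 + rho γ : ℝ) : ℂ) • opB + (γ : ℂ) • opAs)

/-- The adjoint `d*` of `d`. -/
def opDs (γ : ℝ) : Op :=
  star (normConst γ) • (((-1 + rho γ : ℝ) : ℂ) • opA + (γ : ℂ) • opBs)

/-- The adjoint `c^‡*` of `c^‡`. -/
def opCds (γ : ℝ) : Op :=
  star (normConst γ) • (((1 + rho γ : ℝ) : ℂ) • opA - (γ : ℂ) • opBs)

/-- The adjoint `d^‡*` of `d^‡`. -/
def opDds (γ : ℝ) : Op :=
  star (normConst γ) • (((1 + rho γ : ℝ) : ℂ) • opB - (γ : ℂ) • opAs)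

/-- `α = γ / (1 + √(1+γ²))`. -/
def alpha (γ : ℝ) : ℝ := γ / (1 + rho γ)

theorem abs_alpha_lt_one (γ : ℝ) : |alpha γ| < 1 := by
  have h1 : |γ| ≤ rho γ := Real.abs_le_sqrt (by linarith)
  have h2 : 0 < 1 + rho γ := by linarith [abs_nonneg γ]
  rw [alpha, abs_div, abs_of_pos h2, div_lt_one h2]
  linarith

/-- `Ψ₀ = exp (-α a* b*) Φ₀`, in closed form. -/
def psiZero (γ : ℝ) : Sch := squeezed (alpha γ) (abs_alpha_lt_one γ)

/-- `Ψ₀' = exp (α a* b*) Φ₀`, in closed form. -/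
def psiZero' (γ : ℝ) : Sch :=
  squeezed (-alpha γ) (by rw [abs_neg]; exact abs_alpha_lt_one γ)

/-- `Ψ_{m,n} = c^‡^m d^‡^n Ψ₀`. -/
def psi (γ : ℝ) (i : ℕ × ℕ) : L2 := toL2 ((opCd γ ^ i.1 * opDd γ ^ i.2) (psiZero γ))

/-- `Ψ'_{m,n} = c*^m d*^n Ψ₀'`. -/
def psi' (γ : ℝ) (i : ℕ × ℕ) : L2 := toL2 ((opCs γ ^ i.1 * opDs γ ^ i.2) (psiZero' γ))

/-- `E_{m,n} = √(1+γ²) + m (β + √(1+γ²)) + n (-β + √(1+γ²))`. -/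
def energy (β γ : ℝ) (i : ℕ × ℕ) : ℝ :=
  rho γ + i.1 * (β + rho γ) + i.2 * (-β + rho γ)

end PseudoBoson

end

open PseudoBoson

/-!
The argument rests on the canonical commutation relations, on one analytic fact about Gaussians, and
on a cutoff argument that identifies the adjoint of the Hamiltonian.

*Commutation relations.* The bosons, the pseudo-bosons `c, c^‡, d, d^‡`, their formal adjoints and,
up to a factor, the multiplications by the coordinates with `2a`, `2b` are all instances of two
commuting modes (`IsTwoMode`). The relations determine the action of the operators on the states
`fock` over a vacuum, hence the invariance of their span (`IsTwoMode.invariant`), the energies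
(`IsTwoMode.energy_fock`) and all scalar products (`IsTwoMode.inner_fock_fock`). The relations of
the dual system and the form of the adjoint Hamiltonian follow from the uniqueness of formal adjoints.

*Completeness.* A function `f` orthogonal to all polynomial multiples of a Gaussian `G` vanishes,
because the Fourier transform of `conj f * G` is given by its moments
(`eq_zero_of_inner_fockSpan_coordinates`). The pseudo-bosonic transformation being invertible, the span
of the states over a squeezed vacuum is invariant under the multiplications by the coordinates, so
each of the three systems of states is complete.

*The adjoint.* In the Hermite basis `hamOp β γ` only couples `(m, n)` to `(m ± 1, n ± 1)`, with
coefficients that grow linearly. For vectors in the domains of the adjoints of `hamOp β (-γ)` and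
`hamOp β γ`, the difference of the two forms is a sum of diagonal differences
`U (m+1, n+1) - U (m, n)`, where `U` is a linearly growing factor times a summable family; a cutoff of
slope `1 / N` shows that such a sum vanishes (`telescoping_sum_eq_zero`). By orthogonality of graphs
(`adjoint_eq_closure`), the adjoint of `hamOp β γ` on Gaussian polynomials is the closure of
`hamOp β (-γ)` (`adjoint_ham`). In particular all Schwartz functions belong to the domains of the
closures, among them the states over the squeezed vacua, which are not in `𝒟`.

*Conclusions.* An eigenvector of `H` for a further eigenvalue would be orthogonal to the complete system
of eigenvectors of `H*`. The unitary operator, diagonal in the Hermite basis with phases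
`(-i)^(m+n)`, reverses the sign of the pair terms `a*b*` and `ab`, so it takes `H` into `H*`. The
vacua are expanded in the Hermite basis by the recursion `a Ψ = -α b* Ψ`, `b Ψ = -α a* Ψ` and one
Gaussian integral.
-/

noncomputable section

namespace PseudoBoson

/-! ### Two commuting bosonic modes -/

section Modes

variable {V : Type*} [AddCommGroup V] [Module ℂ V]

/-- `A, A'` and `B, B'` satisfy the canonical commutation relations of two commuting modes, with
lowering operators `A`, `B` and raising operators `A'`, `B'`. No adjointness is required. -/
structure IsTwoMode (A A' B B' : Module.End ℂ V) : Prop where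
  comm_a : ⁅A, A'⁆ = 1
  comm_b : ⁅B, B'⁆ = 1
  comm_ab' : ⁅A, B'⁆ = 0
  comm_ba' : ⁅B, A'⁆ = 0
  comm_raise : ⁅A', B'⁆ = 0

/-- The state with occupation numbers `i` obtained by raising the vacuum `v`. -/
def fock (A' B' : Module.End ℂ V) (v : V) (i : ℕ × ℕ) : V := (A' ^ i.1 * B' ^ i.2) v

theorem fock_zero (A' B' : Module.End ℂ V) (v : V) : fock A' B' v (0, 0) = v := by
  simp [fock]

theorem raise_fst_fock (A' B' : Module.End ℂ V) (v : V) (m n : ℕ) :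
    A' (fock A' B' v (m, n)) = fock A' B' v (m + 1, n) := by
  simp [fock, pow_succ']

theorem fock_mem {A' B' : Module.End ℂ V} {v : V} {W : Submodule ℂ V} (hv : v ∈ W)
    (hA : ∀ f ∈ W, A' f ∈ W) (hB : ∀ f ∈ W, B' f ∈ W) (i : ℕ × ℕ) : fock A' B' v i ∈ W := by
  have key : ∀ (T : Module.End ℂ V) (_ : ∀ f ∈ W, T f ∈ W) (k : ℕ) (f : V), f ∈ W →
      (T ^ k) f ∈ W := by
    intro T hT k f hf
    induction k with
    | zero => simpa
    | succ k ih => rw [pow_succ']; exact hT _ ih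
  exact key A' hA _ _ (key B' hB _ _ hv)

/-- The commutator with a lowering operator acts on powers of the raising operator as a derivative.
For `m = 0` the truncated exponent is harmless, its coefficient being zero. -/
theorem lower_pow {A A' : Module.End ℂ V} (h : ⁅A, A'⁆ = 1) (m : ℕ) :
    A * A' ^ m = A' ^ m * A + (m : ℂ) • A' ^ (m - 1) := by
  have h1 : A * A' = A' * A + 1 := by
    rw [← h, Ring.lie_def]; abel
  induction m with
  | zero => simp
  | succ m ih =>
    rw [pow_succ, ← mul_assoc, ih, add_mul, mul_assoc, h1]
    rcases m with _ | m
    · simp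
    · simp only [Nat.add_sub_cancel, smul_mul_assoc, ← pow_succ, mul_add, mul_one]
      rw [← mul_assoc, ← pow_succ]
      push_cast
      module

variable {A A' B B' : Module.End ℂ V} {v : V}

theorem IsTwoMode.commute_raise (h : IsTwoMode A A' B B') : Commute A' B' :=
  sub_eq_zero.1 h.comm_raise

theorem IsTwoMode.swap (h : IsTwoMode A A' B B') : IsTwoMode B B' A A' where
  comm_a := h.comm_b
  comm_b := h.comm_a
  comm_ab' := h.comm_ba'
  comm_ba' := h.comm_ab'
  comm_raise := by rw [Ring.lie_def, h.commute_raise.eq, sub_self]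

theorem IsTwoMode.fock_swap (h : IsTwoMode A A' B B') (m n : ℕ) :
    fock A' B' v (m, n) = fock B' A' v (n, m) := by
  unfold fock
  rw [(h.commute_raise.pow_pow m n).eq]

theorem IsTwoMode.raise_snd_fock (h : IsTwoMode A A' B B') (m n : ℕ) :
    B' (fock A' B' v (m, n)) = fock A' B' v (m, n + 1) := by
  rw [h.fock_swap, raise_fst_fock, h.fock_swap]

theorem IsTwoMode.lower_fst_fock (h : IsTwoMode A A' B B') (hA : A v = 0) (m n : ℕ) :
    A (fock A' B' v (m, n)) = (m : ℂ) • fock A' B' v (m - 1, n) := by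
  have h1 : Commute A B' := sub_eq_zero.1 h.comm_ab'
  have h2 : A * (A' ^ m * B' ^ n) = A' ^ m * B' ^ n * A + (m : ℂ) • (A' ^ (m - 1) * B' ^ n) := by
    rw [← mul_assoc, lower_pow h.comm_a, add_mul, mul_assoc, (h1.pow_right n).eq, smul_mul_assoc,
      mul_assoc]
  have h3 := congrArg (fun T : Module.End ℂ V => T v) h2
  simpa [fock, hA] using h3

theorem IsTwoMode.lower_snd_fock (h : IsTwoMode A A' B B') (hB : B v = 0) (m n : ℕ) :
    B (fock A' B' v (m, n)) = (n : ℂ) • fock A' B' v (m, n - 1) := by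
  rw [h.fock_swap, h.swap.lower_fst_fock hB, h.fock_swap]

/-- The span of the occupation number states over a vacuum. -/
def fockSpan (A' B' : Module.End ℂ V) (v : V) : Submodule ℂ V :=
  Submodule.span ℂ (Set.range (fock A' B' v))

theorem fock_mem_fockSpan (A' B' : Module.End ℂ V) (v : V) (i : ℕ × ℕ) :
    fock A' B' v i ∈ fockSpan A' B' v :=
  Submodule.subset_span ⟨i, rfl⟩

theorem vacuum_mem_fockSpan (A' B' : Module.End ℂ V) (v : V) : v ∈ fockSpan A' B' v := by
  simpa [fock_zero] using fock_mem_fockSpan A' B' v (0, 0)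

theorem fockSpan_le {W : Submodule ℂ V} (hv : v ∈ W)
    (hA : ∀ f ∈ W, A' f ∈ W) (hB : ∀ f ∈ W, B' f ∈ W) : fockSpan A' B' v ≤ W := by
  refine Submodule.span_le.2 ?_
  rintro _ ⟨i, rfl⟩
  exact fock_mem hv hA hB i

theorem map_mem_fockSpan {T : Module.End ℂ V}
    (hT : ∀ m n, T (fock A' B' v (m, n)) ∈ fockSpan A' B' v) :
    ∀ f ∈ fockSpan A' B' v, T f ∈ fockSpan A' B' v := by
  intro f hf
  have h1 : fockSpan A' B' v ≤ (fockSpan A' B' v).comap T := by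
    refine Submodule.span_le.2 ?_
    rintro _ ⟨⟨m, n⟩, rfl⟩
    exact hT m n
  exact h1 hf

/-- The span of the occupation number states is invariant under all four operators. -/
theorem IsTwoMode.invariant (h : IsTwoMode A A' B B') (hA : A v = 0) (hB : B v = 0) :
    (∀ f ∈ fockSpan A' B' v, A f ∈ fockSpan A' B' v) ∧
    (∀ f ∈ fockSpan A' B' v, A' f ∈ fockSpan A' B' v) ∧
    (∀ f ∈ fockSpan A' B' v, B f ∈ fockSpan A' B' v) ∧
    (∀ f ∈ fockSpan A' B' v, B' f ∈ fockSpan A' B' v) := by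
  refine ⟨map_mem_fockSpan fun m n => ?_, map_mem_fockSpan fun m n => ?_,
    map_mem_fockSpan fun m n => ?_, map_mem_fockSpan fun m n => ?_⟩
  · rw [h.lower_fst_fock hA]
    exact Submodule.smul_mem _ _ (fock_mem_fockSpan _ _ _ _)
  · rw [raise_fst_fock]
    exact fock_mem_fockSpan _ _ _ _
  · rw [h.lower_snd_fock hB]
    exact Submodule.smul_mem _ _ (fock_mem_fockSpan _ _ _ _)
  · rw [h.raise_snd_fock]
    exact fock_mem_fockSpan _ _ _ _

/-- The occupation number states are eigenvectors of the number operators. -/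
theorem IsTwoMode.number_fst_fock (h : IsTwoMode A A' B B') (hA : A v = 0) (m n : ℕ) :
    A' (A (fock A' B' v (m, n))) = (m : ℂ) • fock A' B' v (m, n) := by
  rw [h.lower_fst_fock hA, map_smul, raise_fst_fock]
  rcases m with _ | m <;> simp

theorem IsTwoMode.number_snd_fock (h : IsTwoMode A A' B B') (hB : B v = 0) (m n : ℕ) :
    B' (B (fock A' B' v (m, n))) = (n : ℂ) • fock A' B' v (m, n) := by
  rw [h.fock_swap, h.swap.number_fst_fock hB]

end Modes

/-! ### Formal adjoints -/

theorem IsFormalAdjoint.symm {T T' : Op} (h : IsFormalAdjoint T T') : IsFormalAdjoint T' T := by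
  intro f g
  rw [← inner_conj_symm, ← h g f, inner_conj_symm]

theorem IsFormalAdjoint.add {T T' U U' : Op} (h : IsFormalAdjoint T T')
    (k : IsFormalAdjoint U U') : IsFormalAdjoint (T + U) (T' + U') := by
  intro f g
  simp only [LinearMap.add_apply, map_add, inner_add_left, inner_add_right, h f g, k f g]

theorem IsFormalAdjoint.sub {T T' U U' : Op} (h : IsFormalAdjoint T T')
    (k : IsFormalAdjoint U U') : IsFormalAdjoint (T - U) (T' - U') := by
  intro f g
  simp only [LinearMap.sub_apply, map_sub, inner_sub_left, inner_sub_right, h f g, k f g]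

theorem IsFormalAdjoint.smul {T T' : Op} (h : IsFormalAdjoint T T') (z : ℂ) :
    IsFormalAdjoint (z • T) (star z • T') := by
  intro f g
  simp only [LinearMap.smul_apply, map_smul, inner_smul_left, inner_smul_right, h f g]
  rfl

theorem IsFormalAdjoint.real_smul {T T' : Op} (h : IsFormalAdjoint T T') (r : ℝ) :
    IsFormalAdjoint ((r : ℂ) • T) ((r : ℂ) • T') := by
  simpa using h.smul (r : ℂ)

theorem IsFormalAdjoint.mul {T T' U U' : Op} (h : IsFormalAdjoint T T')
    (k : IsFormalAdjoint U U') : IsFormalAdjoint (T * U) (U' * T') := by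
  intro f g
  simp only [Module.End.mul_apply, h _ g, k f]

theorem IsFormalAdjoint.lie {T T' U U' : Op} (h : IsFormalAdjoint T T')
    (k : IsFormalAdjoint U U') : IsFormalAdjoint ⁅T, U⁆ ⁅U', T'⁆ :=
  (h.mul k).sub (k.mul h)

theorem IsFormalAdjoint.one : IsFormalAdjoint 1 1 := fun _ _ => rfl

theorem IsFormalAdjoint.zero : IsFormalAdjoint 0 0 := fun _ _ => by simp

theorem IsFormalAdjoint.unique {T T' T'' : Op} (h : IsFormalAdjoint T T')
    (k : IsFormalAdjoint T T'') : T' = T'' := by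
  refine LinearMap.ext fun g => ?_
  have h1 : ∀ f : Sch, inner ℂ (toL2 f) (toL2 (T' g - T'' g)) = 0 := by
    intro f
    rw [map_sub, inner_sub_right, ← h f g, ← k f g, sub_self]
  have h2 := inner_self_eq_zero.1 (h1 (T' g - T'' g))
  exact sub_eq_zero.1 (toL2_injective (h2.trans (map_zero toL2).symm))

/-- Two systems of modes, each of which has the formal adjoints of the other one: the occupation
number states over the respective vacua are biorthogonal. -/
theorem IsTwoMode.inner_fock_fock {A A' B B' C C' D D' : Op} {v w : Sch}
    (h : IsTwoMode A A' B B') (k : IsTwoMode C C' D D') (hA : A v = 0) (hB : B v = 0)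
    (hC : C w = 0) (hD : D w = 0) (hAC : IsFormalAdjoint A C') (hCA : IsFormalAdjoint A' C)
    (hBD : IsFormalAdjoint B D') (hDB : IsFormalAdjoint B' D) (m n p q : ℕ) :
    inner ℂ (toL2 (fock A' B' v (m, n))) (toL2 (fock C' D' w (p, q))) =
      if m = p ∧ n = q then ((m.factorial * n.factorial : ℕ) : ℂ) * inner ℂ (toL2 v) (toL2 w)
      else 0 := by
  induction m generalizing p with
  | zero =>
    rcases p with _ | p
    · induction n generalizing q with
      | zero =>
        rcases q with _ | q
        · simp [fock_zero]
        · rw [← k.raise_snd_fock, ← hBD, h.lower_snd_fock hB]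
          simp
      | succ n ih =>
        rw [← h.raise_snd_fock, hDB, k.lower_snd_fock hD]
        rcases q with _ | q
        · simp
        · rw [map_smul, inner_smul_right, Nat.add_sub_cancel, ih]
          by_cases hq : n = q
          · subst hq
            simp [Nat.factorial_succ]
            ring
          · simp [hq]
    · rw [← raise_fst_fock, ← hAC, h.lower_fst_fock hA]
      simp
  | succ m ih =>
    rw [← raise_fst_fock, hCA, k.lower_fst_fock hC]
    rcases p with _ | p
    · simp
    · rw [map_smul, inner_smul_right, Nat.add_sub_cancel, ih]
      by_cases hq : m = p
      · subst hq
        by_cases hn : n = q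
        · subst hn
          simp [Nat.factorial_succ]
          ring
        · simp [hn]
      · simp [hq]

/-! ### Canonical commutation relations and adjoints on Schwartz functions -/

theorem derivX_apply (f : Sch) (p : ℝ × ℝ) : derivX f p = fderiv ℝ f p (1, 0) :=
  SchwartzMap.lineDerivOp_apply_eq_fderiv (1, 0) f p

theorem derivY_apply (f : Sch) (p : ℝ × ℝ) : derivY f p = fderiv ℝ f p (0, 1) :=
  SchwartzMap.lineDerivOp_apply_eq_fderiv (0, 1) f p

theorem hasFDerivAt_mulX (f : Sch) (p : ℝ × ℝ) :
    HasFDerivAt (mulX f) ((p.1 : ℂ) • fderiv ℝ f p +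
      (f p) • (Complex.ofRealCLM.comp (ContinuousLinearMap.fst ℝ ℝ ℝ))) p := by
  have h1 : (mulX f : ℝ × ℝ → ℂ) = fun p => (p.1 : ℂ) * f p := funext (mulX_apply f)
  rw [h1]
  exact (Complex.ofRealCLM.comp (ContinuousLinearMap.fst ℝ ℝ ℝ)).hasFDerivAt.mul
    (f.differentiableAt.hasFDerivAt)

theorem hasFDerivAt_mulY (f : Sch) (p : ℝ × ℝ) :
    HasFDerivAt (mulY f) ((p.2 : ℂ) • fderiv ℝ f p +
      (f p) • (Complex.ofRealCLM.comp (ContinuousLinearMap.snd ℝ ℝ ℝ))) p := by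
  have h1 : (mulY f : ℝ × ℝ → ℂ) = fun p => (p.2 : ℂ) * f p := funext (mulY_apply f)
  rw [h1]
  exact (Complex.ofRealCLM.comp (ContinuousLinearMap.snd ℝ ℝ ℝ)).hasFDerivAt.mul
    (f.differentiableAt.hasFDerivAt)

theorem derivX_mulX : derivX * mulX = mulX * derivX + 1 := by
  ext f p
  simp [derivX_apply, mulX_apply, (hasFDerivAt_mulX f p).fderiv]

theorem derivY_mulY : derivY * mulY = mulY * derivY + 1 := by
  ext f p
  simp [derivY_apply, mulY_apply, (hasFDerivAt_mulY f p).fderiv]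

theorem derivX_mulY : derivX * mulY = mulY * derivX := by
  ext f p
  simp [derivX_apply, mulY_apply, (hasFDerivAt_mulY f p).fderiv]

theorem derivY_mulX : derivY * mulX = mulX * derivY := by
  ext f p
  simp [derivY_apply, mulX_apply, (hasFDerivAt_mulX f p).fderiv]

theorem mulX_mulY : mulX * mulY = mulY * mulX := by
  ext f p
  simp [mulX_apply, mulY_apply, mul_left_comm]

theorem derivX_derivY : derivX * derivY = derivY * derivX := by
  ext f p
  have hd : ∀ v : ℝ × ℝ, ∀ q, fderiv ℝ (fun p => fderiv ℝ f p v) q =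
      (fderiv ℝ (fderiv ℝ f) q).flip v := by
    intro v q
    have h1 : DifferentiableAt ℝ (fderiv ℝ f) q :=
      ((f.smooth 2).fderiv_right (m := 1) (by norm_num)).differentiable (by norm_num) q
    have h2 := (h1.hasFDerivAt.clm_apply (hasFDerivAt_const v q)).fderiv
    rw [h2]
    ext <;> simp
  have hX : (derivX f : ℝ × ℝ → ℂ) = fun p => fderiv ℝ f p (1, 0) := funext (derivX_apply f)
  have hY : (derivY f : ℝ × ℝ → ℂ) = fun p => fderiv ℝ f p (0, 1) := funext (derivY_apply f)
  have hs : IsSymmSndFDerivAt ℝ f p :=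
    (f.smooth 2).contDiffAt.isSymmSndFDerivAt (by simp)
  rw [Module.End.mul_apply, Module.End.mul_apply, derivX_apply, derivY_apply, hX, hY, hd, hd]
  exact hs.eq _ _

theorem inner_toL2 (f g : Sch) :
    inner ℂ (toL2 f) (toL2 g) = ∫ p : ℝ × ℝ, g p * star (f p) := by
  rw [L2.inner_def]
  refine integral_congr_ae ?_
  filter_upwards [f.coeFn_toLp 2, g.coeFn_toLp 2] with p h1 h2
  have h3 : (toL2 f : ℝ × ℝ → ℂ) p = f p := h1
  have h4 : (toL2 g : ℝ × ℝ → ℂ) p = g p := h2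
  rw [h3, h4]
  rfl

theorem isFormalAdjoint_mulX : IsFormalAdjoint mulX mulX := by
  intro f g
  rw [inner_toL2, inner_toL2]
  congr 1
  ext p
  simp [mulX_apply]
  ring

theorem isFormalAdjoint_mulY : IsFormalAdjoint mulY mulY := by
  intro f g
  rw [inner_toL2, inner_toL2]
  congr 1
  ext p
  simp [mulY_apply]
  ring

/-- Integration by parts. -/
theorem inner_lineDeriv (v : ℝ × ℝ) (f g : Sch) :
    inner ℂ (toL2 (LineDeriv.lineDerivOpCLM ℂ Sch v f)) (toL2 g) =
      -inner ℂ (toL2 f) (toL2 (LineDeriv.lineDerivOpCLM ℂ Sch v g)) := by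
  have h := SchwartzMap.integral_bilinear_lineDerivOp_right_eq_neg_left (μ := volume) g f
    ((ContinuousLinearMap.mul ℝ ℂ).flip.comp (Complex.conjCLE : ℂ →L[ℝ] ℂ)).flip v
  rw [inner_toL2, inner_toL2]
  exact h

theorem isFormalAdjoint_derivX : IsFormalAdjoint derivX (-derivX) := by
  intro f g
  rw [LinearMap.neg_apply, map_neg, inner_neg_right]
  exact inner_lineDeriv _ f g

theorem isFormalAdjoint_derivY : IsFormalAdjoint derivY (-derivY) := by
  intro f g
  rw [LinearMap.neg_apply, map_neg, inner_neg_right]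
  exact inner_lineDeriv _ f g

theorem isFormalAdjoint_opA : IsFormalAdjoint opA opAs := by
  have h := isFormalAdjoint_mulX.add (isFormalAdjoint_derivX.smul (1 / 2))
  have h1 : mulX + star (1 / 2 : ℂ) • -derivX = opAs := by
    simp [opAs, sub_eq_add_neg]
  rwa [h1] at h

theorem isFormalAdjoint_opB : IsFormalAdjoint opB opBs := by
  have h := isFormalAdjoint_mulY.add (isFormalAdjoint_derivY.smul (1 / 2))
  have h1 : mulY + star (1 / 2 : ℂ) • -derivY = opBs := by
    simp [opBs, sub_eq_add_neg]
  rwa [h1] at h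

theorem isFormalAdjoint_opC (γ : ℝ) : IsFormalAdjoint (opC γ) (opCs γ) :=
  ((isFormalAdjoint_opB.symm.real_smul _).add (isFormalAdjoint_opA.real_smul _)).smul _

theorem isFormalAdjoint_opD (γ : ℝ) : IsFormalAdjoint (opD γ) (opDs γ) :=
  ((isFormalAdjoint_opA.symm.real_smul _).add (isFormalAdjoint_opB.real_smul _)).smul _

theorem isFormalAdjoint_opCd (γ : ℝ) : IsFormalAdjoint (opCd γ) (opCds γ) :=
  ((isFormalAdjoint_opA.symm.real_smul _).sub (isFormalAdjoint_opB.real_smul _)).smul _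

theorem isFormalAdjoint_opDd (γ : ℝ) : IsFormalAdjoint (opDd γ) (opDds γ) :=
  ((isFormalAdjoint_opB.symm.real_smul _).sub (isFormalAdjoint_opA.real_smul _)).smul _

theorem opA_opAs : opA * opAs = opAs * opA + 1 := by
  simp only [opA, opAs, add_mul, mul_add, sub_mul, mul_sub, smul_mul_assoc, mul_smul_comm,
    derivX_mulX]
  module

theorem opB_opBs : opB * opBs = opBs * opB + 1 := by
  simp only [opB, opBs, add_mul, mul_add, sub_mul, mul_sub, smul_mul_assoc, mul_smul_comm,
    derivY_mulY]
  module

theorem opA_opBs : opA * opBs = opBs * opA := by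
  simp only [opA, opBs, add_mul, mul_add, sub_mul, mul_sub, smul_mul_assoc, mul_smul_comm,
    derivX_mulY, derivY_mulX, mulX_mulY, derivX_derivY]
  module

theorem opB_opAs : opB * opAs = opAs * opB := by
  simp only [opB, opAs, add_mul, mul_add, sub_mul, mul_sub, smul_mul_assoc, mul_smul_comm,
    derivX_mulY, derivY_mulX, mulX_mulY, derivX_derivY]
  module

theorem opAs_opBs : opAs * opBs = opBs * opAs := by
  simp only [opAs, opBs, sub_mul, mul_sub, smul_mul_assoc, mul_smul_comm,
    derivX_mulY, derivY_mulX, mulX_mulY, derivX_derivY]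
  module

theorem opA_opB : opA * opB = opB * opA := by
  simp only [opA, opB, add_mul, mul_add, smul_mul_assoc, mul_smul_comm,
    derivX_mulY, derivY_mulX, mulX_mulY, derivX_derivY]
  module

theorem isTwoMode_bosons : IsTwoMode opA opAs opB opBs where
  comm_a := by rw [Ring.lie_def, opA_opAs, add_sub_cancel_left]
  comm_b := by rw [Ring.lie_def, opB_opBs, add_sub_cancel_left]
  comm_ab' := by rw [Ring.lie_def, opA_opBs, sub_self]
  comm_ba' := by rw [Ring.lie_def, opB_opAs, sub_self]
  comm_raise := by rw [Ring.lie_def, opAs_opBs, sub_self]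

/-- Multiplication by the coordinates raises, and `2a`, `2b` lower, the degree of a polynomial
multiple of the vacuum. -/
theorem isTwoMode_coordinates : IsTwoMode ((2 : ℂ) • opA) mulX ((2 : ℂ) • opB) mulY where
  comm_a := by
    simp only [Ring.lie_def, opA, add_mul, mul_add, smul_mul_assoc, mul_smul_comm, derivX_mulX]
    module
  comm_b := by
    simp only [Ring.lie_def, opB, add_mul, mul_add, smul_mul_assoc, mul_smul_comm, derivY_mulY]
    module
  comm_ab' := by
    simp only [Ring.lie_def, opA, add_mul, mul_add, smul_mul_assoc, mul_smul_comm, derivX_mulY,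
      mulX_mulY]
    module
  comm_ba' := by
    simp only [Ring.lie_def, opB, add_mul, mul_add, smul_mul_assoc, mul_smul_comm, derivY_mulX,
      mulX_mulY]
    module
  comm_raise := by rw [Ring.lie_def, mulX_mulY, sub_self]

/-! ### Pseudo-bosons -/

theorem rho_sq (γ : ℝ) : rho γ ^ 2 = 1 + γ ^ 2 := Real.sq_sqrt (by positivity)

theorem one_le_rho (γ : ℝ) : 1 ≤ rho γ := Real.one_le_sqrt.2 (by nlinarith [sq_nonneg γ])

theorem normConst_sq {γ : ℝ} (hγ : γ ≠ 0) :
    normConst γ * normConst γ * (2 * γ * rho γ) = 1 := by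
  have h1 : ((2 * γ * rho γ : ℝ) : ℂ) ≠ 0 := by
    have := one_le_rho γ
    exact_mod_cast mul_ne_zero (mul_ne_zero two_ne_zero hγ) (by linarith)
  have h2 : (2 * γ * rho γ : ℂ) = ((2 * γ * rho γ : ℝ) : ℂ) := by push_cast; rfl
  rw [normConst, ← Complex.cpow_add _ _ h1, h2,
    show (-(1 / 2) + -(1 / 2) : ℂ) = -1 by norm_num, Complex.cpow_neg_one]
  exact inv_mul_cancel₀ h1

theorem normConst_ne_zero {γ : ℝ} (hγ : γ ≠ 0) : normConst γ ≠ 0 := by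
  intro h
  have := normConst_sq hγ
  simp [h] at this

theorem rho_sq_complex (γ : ℝ) : (rho γ : ℂ) ^ 2 = 1 + (γ : ℂ) ^ 2 := by
  exact_mod_cast rho_sq γ

theorem opC_opCd {γ : ℝ} (hγ : γ ≠ 0) : opC γ * opCd γ = opCd γ * opC γ + 1 := by
  have h := normConst_sq hγ
  simp only [opC, opCd, add_mul, mul_add, sub_mul, mul_sub, smul_mul_assoc, mul_smul_comm,
    opA_opAs, opB_opBs, opAs_opBs, opA_opB, smul_add, smul_sub, smul_smul]
  push_cast
  match_scalars <;> first | ring1 | linear_combination h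

theorem opD_opDd {γ : ℝ} (hγ : γ ≠ 0) : opD γ * opDd γ = opDd γ * opD γ + 1 := by
  have h := normConst_sq hγ
  simp only [opD, opDd, add_mul, mul_add, sub_mul, mul_sub, smul_mul_assoc, mul_smul_comm,
    opA_opAs, opB_opBs, opAs_opBs, opA_opB, smul_add, smul_sub, smul_smul]
  push_cast
  match_scalars <;> first | ring1 | linear_combination h

theorem opC_opDd (γ : ℝ) : opC γ * opDd γ = opDd γ * opC γ := by
  simp only [opC, opDd, add_mul, mul_add, sub_mul, mul_sub, smul_mul_assoc, mul_smul_comm,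
    opA_opBs, smul_add, smul_sub, smul_smul]
  push_cast
  match_scalars <;> ring

theorem opD_opCd (γ : ℝ) : opD γ * opCd γ = opCd γ * opD γ := by
  simp only [opD, opCd, add_mul, mul_add, sub_mul, mul_sub, smul_mul_assoc, mul_smul_comm,
    opB_opAs, smul_add, smul_sub, smul_smul]
  push_cast
  match_scalars <;> ring

theorem opCd_opDd (γ : ℝ) : opCd γ * opDd γ = opDd γ * opCd γ := by
  simp only [opCd, opDd, sub_mul, mul_sub, smul_mul_assoc, mul_smul_comm,
    opA_opAs, opB_opBs, opAs_opBs, opA_opB, smul_add, smul_sub, smul_smul]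
  push_cast
  match_scalars <;> ring

theorem opC_opD (γ : ℝ) : opC γ * opD γ = opD γ * opC γ := by
  simp only [opC, opD, add_mul, mul_add, smul_mul_assoc, mul_smul_comm,
    opA_opAs, opB_opBs, opAs_opBs, opA_opB, smul_add, smul_smul]
  push_cast
  match_scalars <;> ring

theorem isTwoMode_pseudoBosons {γ : ℝ} (hγ : γ ≠ 0) :
    IsTwoMode (opC γ) (opCd γ) (opD γ) (opDd γ) where
  comm_a := by rw [Ring.lie_def, opC_opCd hγ, add_sub_cancel_left]
  comm_b := by rw [Ring.lie_def, opD_opDd hγ, add_sub_cancel_left]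
  comm_ab' := by rw [Ring.lie_def, opC_opDd, sub_self]
  comm_ba' := by rw [Ring.lie_def, opD_opCd, sub_self]
  comm_raise := by rw [Ring.lie_def, opCd_opDd, sub_self]

theorem lie_opD_opC (γ : ℝ) : ⁅opD γ, opC γ⁆ = 0 := by
  rw [Ring.lie_def, opC_opD, sub_self]

/-- The dual modes: the relations are the formal adjoints of those of the pseudo-bosons. -/
theorem isTwoMode_dual {γ : ℝ} (hγ : γ ≠ 0) :
    IsTwoMode (opCds γ) (opCs γ) (opDds γ) (opDs γ) where
  comm_a := by
    have h := (isFormalAdjoint_opC γ).lie (isFormalAdjoint_opCd γ)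
    rw [(isTwoMode_pseudoBosons hγ).comm_a] at h
    exact h.unique IsFormalAdjoint.one
  comm_b := by
    have h := (isFormalAdjoint_opD γ).lie (isFormalAdjoint_opDd γ)
    rw [(isTwoMode_pseudoBosons hγ).comm_b] at h
    exact h.unique IsFormalAdjoint.one
  comm_ab' := by
    have h := (isFormalAdjoint_opD γ).lie (isFormalAdjoint_opCd γ)
    rw [(isTwoMode_pseudoBosons hγ).comm_ba'] at h
    exact h.unique IsFormalAdjoint.zero
  comm_ba' := by
    have h := (isFormalAdjoint_opC γ).lie (isFormalAdjoint_opDd γ)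
    rw [(isTwoMode_pseudoBosons hγ).comm_ab'] at h
    exact h.unique IsFormalAdjoint.zero
  comm_raise := by
    have h := (isFormalAdjoint_opD γ).lie (isFormalAdjoint_opC γ)
    rw [lie_opD_opC] at h
    exact h.unique IsFormalAdjoint.zero

/-- The Hamiltonian is diagonal in the pseudo-bosonic number operators. -/
theorem hamOp_eq (β : ℝ) {γ : ℝ} (hγ : γ ≠ 0) :
    hamOp β γ = (β : ℂ) • (opCd γ * opC γ - opDd γ * opD γ)
      + (rho γ : ℂ) • (opCd γ * opC γ + opD γ * opDd γ) := by
  have h := normConst_sq hγ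
  have hr := rho_sq_complex γ
  simp only [hamOp, opC, opCd, opD, opDd, add_mul, mul_add, sub_mul, mul_sub, smul_mul_assoc,
    mul_smul_comm, opA_opAs, opB_opBs, opAs_opBs, opA_opB, smul_add, smul_sub, smul_smul]
  push_cast
  match_scalars
  · linear_combination -(1 + β) * h
  · linear_combination -(1 - β) * h
  · linear_combination -h
  · linear_combination -γ * h - 2 * normConst γ ^ 2 * rho γ * hr
  · linear_combination γ * h

theorem isFormalAdjoint_hamOp (β γ : ℝ) : IsFormalAdjoint (hamOp β γ) (hamOp β (-γ)) := by
  have hA := isFormalAdjoint_opA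
  have hB := isFormalAdjoint_opB
  have h := (((hA.symm.mul hA).add (hB.mul hB.symm)).add
    (((hA.symm.mul hA).sub (hB.symm.mul hB)).real_smul β)).add
    (((hA.symm.mul hB.symm).sub (hA.mul hB)).real_smul γ)
  have h1 : hamOp β (-γ) = opAs * opA + opB * opBs + (β : ℂ) • (opAs * opA - opBs * opB) +
      (γ : ℂ) • (opB * opA - opBs * opAs) := by
    rw [hamOp, opAs_opBs, opA_opB]
    push_cast
    module
  rw [h1]
  exact h

/-- The adjoint Hamiltonian is diagonal in the number operators of the dual modes. -/
theorem hamOp_neg_eq (β : ℝ) {γ : ℝ} (hγ : γ ≠ 0) :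
    hamOp β (-γ) = (β : ℂ) • (opCs γ * opCds γ - opDs γ * opDds γ)
      + (rho γ : ℂ) • (opCs γ * opCds γ + opDds γ * opDs γ) := by
  refine (isFormalAdjoint_hamOp β γ).unique ?_
  rw [hamOp_eq β hγ]
  have hC := isFormalAdjoint_opC γ
  have hD := isFormalAdjoint_opD γ
  have hC' := isFormalAdjoint_opCd γ
  have hD' := isFormalAdjoint_opDd γ
  exact (((hC'.mul hC).sub (hD'.mul hD)).real_smul β).add
    (((hC'.mul hC).add (hD.mul hD')).real_smul (rho γ))

/-- The occupation number states diagonalize an operator that is linear in the number operators. -/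
theorem IsTwoMode.energy_fock {A A' B B' : Op} {v : Sch} (h : IsTwoMode A A' B B') (hA : A v = 0)
    (hB : B v = 0) (β γ : ℝ) (i : ℕ × ℕ) :
    ((β : ℂ) • (A' * A - B' * B) + (rho γ : ℂ) • (A' * A + B * B')) (fock A' B' v i) =
      (energy β γ i : ℂ) • fock A' B' v i := by
  obtain ⟨m, n⟩ := i
  have h1 : B * B' = B' * B + 1 := by
    rw [← h.comm_b, Ring.lie_def]
    abel
  rw [h1]
  simp only [LinearMap.add_apply, LinearMap.smul_apply, LinearMap.sub_apply, Module.End.mul_apply,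
    Module.End.one_apply, h.number_fst_fock hA, h.number_snd_fock hB, energy]
  push_cast
  module

/-! ### The vacua -/

theorem hasFDerivAt_squeezed (α : ℝ) (hα : |α| < 1) (p : ℝ × ℝ) :
    HasFDerivAt (squeezed α hα) ((squeezed α hα p) •
      Complex.ofRealCLM.comp (-((1 + α ^ 2) / (1 - α ^ 2)) •
        ((2 * p.1) • ContinuousLinearMap.fst ℝ ℝ ℝ + (2 * p.2) • ContinuousLinearMap.snd ℝ ℝ ℝ)
        - (4 * α / (1 - α ^ 2)) • (p.1 • ContinuousLinearMap.snd ℝ ℝ ℝ +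
          p.2 • ContinuousLinearMap.fst ℝ ℝ ℝ))) p := by
  have h0 : (squeezed α hα : ℝ × ℝ → ℂ) = fun p => (((Real.sqrt (1 - α ^ 2))⁻¹ *
      Real.exp (-((1 + α ^ 2) / (1 - α ^ 2)) * (p.1 ^ 2 + p.2 ^ 2)
        - 4 * α / (1 - α ^ 2) * (p.1 * p.2)) : ℝ) : ℂ) :=
    funext fun p => squeezed_apply α hα p.1 p.2
  have hx : HasFDerivAt (fun p : ℝ × ℝ => p.1) (ContinuousLinearMap.fst ℝ ℝ ℝ) p := hasFDerivAt_fst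
  have hy : HasFDerivAt (fun p : ℝ × ℝ => p.2) (ContinuousLinearMap.snd ℝ ℝ ℝ) p := hasFDerivAt_snd
  have h1 := ((((hx.pow 2).add (hy.pow 2)).const_mul (-((1 + α ^ 2) / (1 - α ^ 2)))).sub
    ((hx.mul hy).const_mul (4 * α / (1 - α ^ 2)))).exp.const_mul ((Real.sqrt (1 - α ^ 2))⁻¹)
  have h2 := Complex.ofRealCLM.hasFDerivAt.comp p h1
  rw [h0]
  refine h2.congr_fderiv ?_
  ext <;> simp <;> ring

theorem one_sub_sq_ne_zero {α : ℝ} (hα : |α| < 1) : 1 - α ^ 2 ≠ 0 := by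
  have := (sq_lt_one_iff_abs_lt_one α).2 hα
  linarith

theorem opA_squeezed (α : ℝ) (hα : |α| < 1) :
    opA (squeezed α hα) = (-α : ℂ) • opBs (squeezed α hα) := by
  have h0 : (1 - (α : ℂ) ^ 2) ≠ 0 := by exact_mod_cast one_sub_sq_ne_zero hα
  ext p
  simp [opA, opBs, mulX_apply, mulY_apply, derivX_apply, derivY_apply,
    (hasFDerivAt_squeezed α hα p).fderiv]
  field_simp
  ring

theorem opB_squeezed (α : ℝ) (hα : |α| < 1) :
    opB (squeezed α hα) = (-α : ℂ) • opAs (squeezed α hα) := by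
  have h0 : (1 - (α : ℂ) ^ 2) ≠ 0 := by exact_mod_cast one_sub_sq_ne_zero hα
  ext p
  simp [opB, opAs, mulX_apply, mulY_apply, derivX_apply, derivY_apply,
    (hasFDerivAt_squeezed α hα p).fderiv]
  field_simp
  ring

theorem opA_vacuum : opA vacuum = 0 := by
  simpa [vacuum] using opA_squeezed 0 (by simp)

theorem opB_vacuum : opB vacuum = 0 := by
  simpa [vacuum] using opB_squeezed 0 (by simp)

theorem alpha_mul (γ : ℝ) : (γ : ℂ) * alpha γ = rho γ - 1 := by
  have h1 := one_le_rho γ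
  have h2 := rho_sq γ
  have h3 : γ * alpha γ = rho γ - 1 := by
    rw [alpha]
    field_simp
    linarith
  exact_mod_cast h3

theorem mul_alpha (γ : ℝ) : (1 + rho γ : ℂ) * alpha γ = γ := by
  have h1 := one_le_rho γ
  have h3 : (1 + rho γ) * alpha γ = γ := by
    rw [alpha]
    field_simp
  exact_mod_cast h3

theorem opC_psiZero (γ : ℝ) : opC γ (psiZero γ) = 0 := by
  have h := alpha_mul γ
  simp only [opC, psiZero, LinearMap.smul_apply, LinearMap.add_apply, opA_squeezed]
  push_cast
  match_scalars
  linear_combination -normConst γ * h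

theorem opD_psiZero (γ : ℝ) : opD γ (psiZero γ) = 0 := by
  have h := alpha_mul γ
  simp only [opD, psiZero, LinearMap.smul_apply, LinearMap.add_apply, opB_squeezed]
  push_cast
  match_scalars
  linear_combination -normConst γ * h

theorem opCds_psiZero' (γ : ℝ) : opCds γ (psiZero' γ) = 0 := by
  have h := mul_alpha γ
  simp only [opCds, psiZero', LinearMap.smul_apply, LinearMap.sub_apply, opA_squeezed]
  push_cast
  match_scalars
  linear_combination star (normConst γ) * h

theorem opDds_psiZero' (γ : ℝ) : opDds γ (psiZero' γ) = 0 := by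
  have h := mul_alpha γ
  simp only [opDds, psiZero', LinearMap.smul_apply, LinearMap.sub_apply, opB_squeezed]
  push_cast
  match_scalars
  linear_combination star (normConst γ) * h

theorem squeezed_ne_zero (α : ℝ) (hα : |α| < 1) (p : ℝ × ℝ) : squeezed α hα p ≠ 0 := by
  have h1 := (sq_lt_one_iff_abs_lt_one α).2 hα
  have h2 : 0 < Real.sqrt (1 - α ^ 2) := Real.sqrt_pos.2 (by linarith)
  rw [← Prod.mk.eta (p := p), squeezed_apply]
  exact_mod_cast (by positivity)

/-! ### Completeness of polynomials with a Gaussian weight -/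

theorem ae_eq_zero_of_integral_cexp_real {E : Type*} [NormedAddCommGroup E] [NormedSpace ℝ E]
    [CompleteSpace E] [MeasurableSpace E] [BorelSpace E] [SecondCountableTopology E]
    {μ : Measure E} [SigmaFinite μ] {u : E → ℝ} (hu : Integrable u μ)
    (h : ∀ L : StrongDual ℝ E, ∫ p, (u p : ℂ) * Complex.exp (L p * Complex.I) ∂μ = 0) :
    u =ᵐ[μ] 0 := by
  have hm : AEMeasurable u μ := hu.aemeasurable
  have hm' : AEMeasurable (fun p => -u p) μ := hm.neg
  have hf1 : IsFiniteMeasure (μ.withDensity fun p => ENNReal.ofReal (u p)) :=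
    isFiniteMeasure_withDensity_ofReal hu.2
  have hf2 : IsFiniteMeasure (μ.withDensity fun p => ENNReal.ofReal (-u p)) :=
    isFiniteMeasure_withDensity_ofReal hu.neg.2
  have hexp : ∀ L : StrongDual ℝ E, Continuous fun p => Complex.exp (L p * Complex.I) := by
    intro L
    fun_prop
  have hnorm : ∀ (L : StrongDual ℝ E) (p : E), ‖Complex.exp (L p * Complex.I)‖ ≤ 1 :=
    fun L p => (Complex.norm_exp_ofReal_mul_I (L p)).le
  have hint : ∀ (L : StrongDual ℝ E) (w : E → ℝ), Integrable w μ →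
      Integrable (fun p => (w p : ℂ) * Complex.exp (L p * Complex.I)) μ := fun L w hw =>
    hw.ofReal.mul_bdd (c := 1) (hexp L).aestronglyMeasurable (Filter.Eventually.of_forall (hnorm L))
  have hmeas : (μ.withDensity fun p => ENNReal.ofReal (u p)) =
      μ.withDensity fun p => ENNReal.ofReal (-u p) := by
    refine Measure.ext_of_charFunDual (funext fun L => ?_)
    rw [charFunDual_apply, charFunDual_apply,
      integral_withDensity_eq_integral_toReal_smul₀ hm.ennreal_ofReal
        (Filter.Eventually.of_forall fun _ => ENNReal.ofReal_lt_top),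
      integral_withDensity_eq_integral_toReal_smul₀ hm'.ennreal_ofReal
        (Filter.Eventually.of_forall fun _ => ENNReal.ofReal_lt_top), ← sub_eq_zero,
      ← integral_sub, ← h L]
    · refine integral_congr_ae (Filter.Eventually.of_forall fun p => ?_)
      have h1 : max (u p) 0 - max (-u p) 0 = u p := max_zero_sub_max_neg_zero_eq_self (u p)
      simp only [ENNReal.toReal_ofReal', Complex.real_smul]
      rw [← sub_mul, ← Complex.ofReal_sub, h1]
    · simp only [ENNReal.toReal_ofReal', Complex.real_smul]
      exact hint L _ hu.pos_part
    · simp only [ENNReal.toReal_ofReal', Complex.real_smul]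
      exact hint L _ hu.neg_part
  have h2 := (withDensity_eq_iff hm.ennreal_ofReal hm'.ennreal_ofReal
    hu.lintegral_lt_top.ne).1 hmeas
  filter_upwards [h2] with p hp
  have h3 := congrArg ENNReal.toReal hp
  simp only [ENNReal.toReal_ofReal'] at h3
  have h1 : max (u p) 0 - max (-u p) 0 = u p := max_zero_sub_max_neg_zero_eq_self (u p)
  rw [← h1, h3, sub_self, Pi.zero_apply]

/-- An integrable function with vanishing Fourier transform vanishes almost everywhere: the positive
and negative parts of its real and imaginary parts are densities of measures with the same
characteristic function. -/
theorem ae_eq_zero_of_integral_cexp {E : Type*} [NormedAddCommGroup E] [NormedSpace ℝ E]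
    [CompleteSpace E] [MeasurableSpace E] [BorelSpace E] [SecondCountableTopology E]
    {μ : Measure E} [SigmaFinite μ] {u : E → ℂ} (hu : Integrable u μ)
    (h : ∀ L : StrongDual ℝ E, ∫ p, u p * Complex.exp (L p * Complex.I) ∂μ = 0) :
    u =ᵐ[μ] 0 := by
  have hexp : ∀ L : StrongDual ℝ E, Continuous fun p => Complex.exp (L p * Complex.I) := by
    intro L
    fun_prop
  have hint : ∀ (L : StrongDual ℝ E) (w : E → ℂ), Integrable w μ →
      Integrable (fun p => w p * Complex.exp (L p * Complex.I)) μ := fun L w hw =>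
    hw.mul_bdd (c := 1) (hexp L).aestronglyMeasurable
      (Filter.Eventually.of_forall fun p => (Complex.norm_exp_ofReal_mul_I (L p)).le)
  have hu' : Integrable (fun p => star (u p)) μ :=
    (Complex.conjCLE : ℂ →L[ℝ] ℂ).integrable_comp hu
  have h' : ∀ L : StrongDual ℝ E, ∫ p, star (u p) * Complex.exp (L p * Complex.I) ∂μ = 0 := by
    intro L
    have h1 := congrArg star (h (-L))
    rw [star_zero, Complex.star_def, ← integral_conj] at h1
    rw [← h1]
    refine integral_congr_ae (Filter.Eventually.of_forall fun p => ?_)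
    simp [← Complex.exp_conj]
  have hre := ae_eq_zero_of_integral_cexp_real hu.re fun L => by
    have h1 := integral_add (hint L u hu) (hint L _ hu')
    rw [h L, h' L, add_zero] at h1
    rw [← mul_eq_zero_iff_left (two_ne_zero' ℂ), ← integral_const_mul, ← h1]
    refine integral_congr_ae (Filter.Eventually.of_forall fun p => ?_)
    have h2 : ((u p).re : ℂ) = (u p + star (u p)) / 2 := Complex.re_eq_add_conj _
    simp only [RCLike.re_to_complex, h2]
    ring
  have him := ae_eq_zero_of_integral_cexp_real hu.im fun L => by
    have h1 := integral_sub (hint L u hu) (hint L _ hu')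
    rw [h L, h' L, sub_zero] at h1
    have hI : (2 * Complex.I : ℂ) ≠ 0 := by simp
    rw [← mul_eq_zero_iff_left hI, ← integral_const_mul, ← h1]
    refine integral_congr_ae (Filter.Eventually.of_forall fun p => ?_)
    have h2 : ((u p).im : ℂ) = (u p - star (u p)) / (2 * Complex.I) := Complex.im_eq_sub_conj _
    simp only [RCLike.im_to_complex, h2]
    field_simp
  filter_upwards [hre, him] with p h1 h2
  exact Complex.ext h1 h2

theorem mul_coord_pow_apply (s t : ℝ) (f : Sch) (k : ℕ) (p : ℝ × ℝ) :
    ((((s : ℂ) • mulX + (t : ℂ) • mulY) ^ k) f) p = ((s * p.1 + t * p.2 : ℝ) : ℂ) ^ k * f p := by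
  induction k with
  | zero => simp
  | succ k ih =>
    rw [pow_succ', Module.End.mul_apply]
    simp only [LinearMap.add_apply, LinearMap.smul_apply, add_apply, smul_apply, mulX_apply,
      mulY_apply, ih, smul_eq_mul]
    push_cast
    ring

/-- A Gaussian times an exponential function is dominated by a wider Gaussian. -/
theorem exists_schwartz_bound (α : ℝ) (hα : |α| < 1) (K : ℝ) :
    ∃ G : Sch, ∀ p : ℝ × ℝ, ‖squeezed α hα p‖ * Real.exp (K * ‖p‖) ≤ ‖G p‖ := by
  have h1 := (sq_lt_one_iff_abs_lt_one α).2 hα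
  set δ := (1 - |α|) ^ 2 / (1 - α ^ 2) with hδ
  have hδ0 : 0 < δ := by
    have h2 : 0 < 1 - |α| := by linarith
    have h3 : 0 < 1 - α ^ 2 := by linarith
    positivity
  -- the exponent is halved, which leaves room for the exponential
  have hT : Function.HasTemperateGrowth fun p : ℝ × ℝ => quadForm α p / 2 := by
    have h2 := (Function.HasTemperateGrowth.const (E := ℝ × ℝ) (2⁻¹ : ℝ)).mul (quadForm_temperate α)
    have h3 : (fun p : ℝ × ℝ => quadForm α p / 2) = fun p => 2⁻¹ * quadForm α p :=
      funext fun p => div_eq_inv_mul _ _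
    rw [h3]
    exact h2
  set N : ℝ := (Real.sqrt (1 - α ^ 2))⁻¹
  have hN : 0 ≤ N := by positivity
  refine ⟨((N * Real.exp (K ^ 2 / (2 * δ)) : ℝ) : ℂ) •
    SchwartzMap.postcompCLM Complex.ofRealCLM (expNegReal _ hT (δ / 2) (by positivity)
      (fun p => by have := quadForm_coercive hα p; linarith)), fun p => ?_⟩
  have hG : ‖squeezed α hα p‖ = N * Real.exp (quadForm α p) := by
    rw [← Prod.mk.eta (p := p), squeezed_apply, Complex.norm_real, Real.norm_of_nonneg]
    · rfl
    · positivity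
  have hR : ∀ q : SchwartzMap (ℝ × ℝ) ℝ, (SchwartzMap.postcompCLM Complex.ofRealCLM q : Sch) p
    = (q p : ℂ) := fun _ => rfl
  rw [hG, smul_apply, hR, smul_eq_mul, ← Complex.ofReal_mul, Complex.norm_real]
  refine le_trans ?_ (le_abs_self _)
  have hv : expNegReal _ hT (δ / 2) (by positivity)
      (fun p => by have := quadForm_coercive hα p; linarith) p = Real.exp (quadForm α p / 2) := rfl
  rw [hv, mul_assoc, mul_assoc, ← Real.exp_add, ← Real.exp_add]
  refine mul_le_mul_of_nonneg_left (Real.exp_le_exp.2 ?_) hN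
  have h2 := quadForm_coercive hα p
  have h3 : K ^ 2 / (2 * δ) - K * ‖p‖ + δ / 2 * ‖p‖ ^ 2 = δ / 2 * (‖p‖ - K / δ) ^ 2 := by
    field_simp
    ring
  nlinarith [mul_nonneg (half_pos hδ0).le (sq_nonneg (‖p‖ - K / δ))]

/-- A function orthogonal to all products of a polynomial with a Gaussian vanishes: the Fourier
transform of its product with the Gaussian can be expanded into a power series of moments. -/
theorem eq_zero_of_inner_fockSpan_coordinates (α : ℝ) (hα : |α| < 1) (f : L2)
    (h : ∀ g ∈ fockSpan mulX mulY (squeezed α hα), inner ℂ f (toL2 g) = 0) : f = 0 := by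
  set G := squeezed α hα with hGdef
  have hmom : ∀ (s t : ℝ) (k : ℕ),
      ∫ p : ℝ × ℝ, ((s * p.1 + t * p.2 : ℝ) : ℂ) ^ k * (star (f p) * G p) = 0 := by
    intro s t k
    have hmem : (((s : ℂ) • mulX + (t : ℂ) • mulY) ^ k) G ∈ fockSpan mulX mulY G := by
      obtain ⟨-, hX, -, hY⟩ := isTwoMode_coordinates.invariant (v := vacuum)
        (by simp [opA_vacuum]) (by simp [opB_vacuum])
      have hinv : ∀ g ∈ fockSpan mulX mulY G,
          ((s : ℂ) • mulX + (t : ℂ) • mulY) g ∈ fockSpan mulX mulY G := by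
        refine map_mem_fockSpan fun m n => ?_
        rw [LinearMap.add_apply, LinearMap.smul_apply, LinearMap.smul_apply, raise_fst_fock,
          isTwoMode_coordinates.raise_snd_fock]
        exact Submodule.add_mem _ (Submodule.smul_mem _ _ (fock_mem_fockSpan _ _ _ _))
          (Submodule.smul_mem _ _ (fock_mem_fockSpan _ _ _ _))
      induction k with
      | zero => simpa using vacuum_mem_fockSpan mulX mulY G
      | succ k ih =>
        rw [pow_succ']
        exact hinv _ ih
    have h1 := h _ hmem
    rw [L2.inner_def] at h1
    rw [← h1]
    refine integral_congr_ae ?_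
    filter_upwards [SchwartzMap.coeFn_toLp ((((s : ℂ) • mulX + (t : ℂ) • mulY) ^ k) G) 2] with p h2
    have h3 : (toL2 ((((s : ℂ) • mulX + (t : ℂ) • mulY) ^ k) G) : ℝ × ℝ → ℂ) p =
      ((((s : ℂ) • mulX + (t : ℂ) • mulY) ^ k) G) p := h2
    rw [h3, mul_coord_pow_apply]
    simp only [RCLike.inner_apply]
    simp
    ring
  have hf : MemLp (f : ℝ × ℝ → ℂ) 2 volume := Lp.memLp f
  have hfs : MemLp (fun p => star (f p)) 2 (volume : Measure (ℝ × ℝ)) := hf.star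
  have hintE : ∀ K : ℝ, Integrable (fun p : ℝ × ℝ => ‖star (f p) * G p‖ * Real.exp (K * ‖p‖)) := by
    intro K
    obtain ⟨B, hB⟩ := exists_schwartz_bound α hα K
    refine (hfs.integrable_mul (B.memLp 2 volume)).mono ?_
      (Filter.Eventually.of_forall fun p => ?_)
    · exact ((hfs.1.mul G.continuous.aestronglyMeasurable).norm).mul
        (by fun_prop : Continuous fun p : ℝ × ℝ => Real.exp (K * ‖p‖)).aestronglyMeasurable
    · rw [norm_mul, norm_norm, Real.norm_of_nonneg (Real.exp_pos _).le, Pi.mul_apply, norm_mul,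
        norm_mul, mul_assoc]
      exact mul_le_mul_of_nonneg_left (hB p) (norm_nonneg _)
  have hint : Integrable (fun p : ℝ × ℝ => star (f p) * G p) := by
    have h1 := hintE 0
    simp only [zero_mul, Real.exp_zero, mul_one] at h1
    exact (integrable_norm_iff (hfs.1.mul G.continuous.aestronglyMeasurable)).1 h1
  have hzero := ae_eq_zero_of_integral_cexp hint fun L => by
    set s := L (1, 0)
    set t := L (0, 1)
    have hL : ∀ p : ℝ × ℝ, L p = s * p.1 + t * p.2 := by
      intro p
      have h1 : p = p.1 • ((1, 0) : ℝ × ℝ) + p.2 • ((0, 1) : ℝ × ℝ) := by ext <;> simp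
      have h2 := congrArg L h1
      rw [map_add, map_smul, map_smul, smul_eq_mul, smul_eq_mul] at h2
      rw [h2, mul_comm, mul_comm p.2]
    have hz : ∀ k : ℕ, ∫ p : ℝ × ℝ,
        (star (f p) * G p) * ((L p * Complex.I) ^ k / k.factorial) = 0 := by
      intro k
      rw [← mul_zero (Complex.I ^ k / k.factorial : ℂ), ← hmom s t k, ← integral_const_mul]
      refine integral_congr_ae (Filter.Eventually.of_forall fun p => ?_)
      simp only [hL, mul_pow]
      ring
    have hsum := hasSum_integral_of_dominated_convergence
      (μ := (volume : Measure (ℝ × ℝ)))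
      (F := fun (k : ℕ) (p : ℝ × ℝ) => (star (f p) * G p) * ((L p * Complex.I) ^ k / k.factorial))
      (f := fun p => (star (f p) * G p) * Complex.exp (L p * Complex.I))
      (fun k p => ‖star (f p) * G p‖ * ((‖L‖ * ‖p‖) ^ k / k.factorial)) ?_ ?_ ?_ ?_ ?_
    · simp only [hz] at hsum
      exact hsum.unique hasSum_zero
    · intro k
      exact hint.1.mul (by fun_prop : Continuous fun p : ℝ × ℝ =>
        ((L p * Complex.I) ^ k / k.factorial : ℂ)).aestronglyMeasurable
    · intro k
      refine Filter.Eventually.of_forall fun p => ?_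
      rw [norm_mul, norm_div, norm_pow, norm_mul (L p : ℂ), Complex.norm_I, mul_one,
        Complex.norm_real, Complex.norm_natCast]
      gcongr
      exact L.le_opNorm p
    · exact Filter.Eventually.of_forall fun p =>
        ((Real.summable_pow_div_factorial _).mul_left _)
    · simp_rw [tsum_mul_left]
      refine (hintE ‖L‖).congr (Filter.Eventually.of_forall fun p => ?_)
      simp only
      rw [Real.exp_eq_exp_ℝ, NormedSpace.exp_eq_tsum_div]
    · refine Filter.Eventually.of_forall fun p => HasSum.mul_left _ ?_
      rw [Complex.exp_eq_exp_ℂ]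
      exact NormedSpace.expSeries_div_hasSum_exp _
  refine (Lp.eq_zero_iff_ae_eq_zero).2 ?_
  filter_upwards [hzero] with p hp
  simpa [G, squeezed_ne_zero] using hp

/-! ### Adjoints and closures of unbounded operators -/

section Adjoint

variable {E : Type*} [NormedAddCommGroup E] [InnerProductSpace ℂ E]

theorem adjoint_topologicalClosure (g : Submodule ℂ (E × E)) :
    g.topologicalClosure.adjoint = g.adjoint := by
  refine le_antisymm (fun x hx => ?_) (fun x hx => ?_)
  · rw [Submodule.mem_adjoint_iff] at hx ⊢
    exact fun a b hab => hx a b (g.le_topologicalClosure hab)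
  · rw [Submodule.mem_adjoint_iff] at hx ⊢
    have h1 : _root_.IsClosed {p : E × E | inner ℂ p.2 x.1 - inner ℂ p.1 x.2 = 0} :=
      isClosed_eq (by fun_prop) continuous_const
    have h2 : closure (g : Set (E × E)) ⊆ {p : E × E | inner ℂ p.2 x.1 - inner ℂ p.1 x.2 = 0} :=
      closure_minimal (fun p hp => hx p.1 p.2 hp) h1
    exact fun a b hab => h2 hab

variable [CompleteSpace E]

theorem adjoint_adjoint_le_topologicalClosure (g : Submodule ℂ (E × E)) :
    g.adjoint.adjoint ≤ g.topologicalClosure := by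
  intro x hx
  -- `E × E` carries the supremum norm, so orthogonality of graphs refers to `WithLp 2 (E × E)`
  set Φ := WithLp.prodContinuousLinearEquiv 2 ℂ E E
  set K : Submodule ℂ (WithLp 2 (E × E)) := g.comap Φ.toLinearEquiv.toLinearMap with hK
  have h1 : WithLp.toLp 2 x ∈ Kᗮᗮ := by
    rw [Submodule.mem_orthogonal]
    intro y hy
    rw [Submodule.mem_orthogonal] at hy
    have h2 : (y.snd, -y.fst) ∈ g.adjoint := by
      rw [Submodule.mem_adjoint_iff]
      intro a b hab
      have h3 := hy (WithLp.toLp 2 (a, b)) hab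
      rw [WithLp.prod_inner_apply] at h3
      simpa [add_comm] using h3
    have h4 := (Submodule.mem_adjoint_iff _ _).1 hx _ _ h2
    rw [WithLp.prod_inner_apply]
    change inner ℂ y.fst x.1 + inner ℂ y.snd x.2 = 0
    rw [inner_neg_left] at h4
    linear_combination -h4
  rw [Submodule.orthogonal_orthogonal_eq_closure] at h1
  have h5 : WithLp.toLp 2 x ∈ closure (Φ ⁻¹' (g : Set (E × E))) := h1
  exact map_mem_closure Φ.continuous h5 fun y hy => hy

theorem adjoint_closure {T : E →ₗ.[ℂ] E} (hT : Dense (T.domain : Set E)) (hc : T.IsClosable) :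
    T.closure.adjoint = T.adjoint := by
  have h1 : Dense (T.closure.domain : Set E) := hT.mono T.le_closure.1
  refine LinearPMap.eq_of_eq_graph ?_
  rw [LinearPMap.adjoint_graph_eq_graph_adjoint hT, LinearPMap.adjoint_graph_eq_graph_adjoint h1,
    ← hc.graph_closure_eq_closure_graph, adjoint_topologicalClosure]

/-- If `T'` is a restriction of the adjoint of `T`, and the adjoints of `T` and `T'` are adjoint to
each other as forms, then `T'` is a core for the adjoint of `T`. -/
theorem adjoint_eq_closure {T T' : E →ₗ.[ℂ] E} (hT : Dense (T.domain : Set E))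
    (hle : T' ≤ T.adjoint)
    (key : ∀ v v' f f' : E, (v, v') ∈ T'.graph.adjoint → (f, f') ∈ T.graph.adjoint →
      inner ℂ v' f = inner ℂ v f') :
    T.adjoint = T'.closure := by
  have hclosed := LinearPMap.adjoint_isClosed hT
  have hc : T'.IsClosable := hclosed.isClosable.leIsClosable hle
  refine LinearPMap.eq_of_eq_graph ?_
  rw [← hc.graph_closure_eq_closure_graph]
  refine le_antisymm ?_ ?_
  · rw [LinearPMap.adjoint_graph_eq_graph_adjoint hT]
    rintro ⟨f, f'⟩ hf
    refine adjoint_adjoint_le_topologicalClosure _ ?_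
    rw [Submodule.mem_adjoint_iff]
    intro v v' hv
    rw [key v v' f f' hv hf, sub_self]
  · exact Submodule.topologicalClosure_minimal _ (LinearPMap.le_graph_of_le hle) hclosed

end Adjoint

/-! ### A telescoping sum -/

/-- A cutoff on the lattice of occupation numbers, of slope `1 / (N + 1)`. -/
def cutoff (N : ℕ) (i : ℕ × ℕ) : ℝ := max 0 (1 - ((i.1 + i.2 : ℕ) : ℝ) / (N + 1))

theorem cutoff_eq_zero {N : ℕ} {i : ℕ × ℕ} (h : N + 1 ≤ i.1 + i.2) : cutoff N i = 0 := by
  have h1 : ((N : ℝ) + 1) ≤ ((i.1 + i.2 : ℕ) : ℝ) := by exact_mod_cast h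
  have h2 : 1 ≤ ((i.1 + i.2 : ℕ) : ℝ) / (N + 1) := (one_le_div (by positivity)).2 h1
  exact max_eq_left (by linarith)

theorem cutoff_nonneg (N : ℕ) (i : ℕ × ℕ) : 0 ≤ cutoff N i := le_max_left _ _

theorem cutoff_le_one (N : ℕ) (i : ℕ × ℕ) : cutoff N i ≤ 1 := by
  refine max_le zero_le_one ?_
  have : 0 ≤ ((i.1 + i.2 : ℕ) : ℝ) / (N + 1) := by positivity
  linarith

theorem tendsto_cutoff (i : ℕ × ℕ) :
    Filter.Tendsto (fun N => cutoff N i) Filter.atTop (nhds 1) := by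
  have h1 : Filter.Tendsto (fun N : ℕ => ((i.1 + i.2 : ℕ) : ℝ) / ((N : ℝ) + 1)) Filter.atTop
      (nhds 0) :=
    tendsto_const_nhds.div_atTop (Filter.tendsto_atTop_add_const_right _ _
      tendsto_natCast_atTop_atTop)
  have h2 := (tendsto_const_nhds (x := (0 : ℝ))).max ((tendsto_const_nhds (x := (1 : ℝ))).sub h1)
  rwa [sub_zero, max_eq_right zero_le_one] at h2

theorem abs_cutoff_sub_le (N m n : ℕ) :
    |cutoff N (m, n) - cutoff N (m + 1, n + 1)| ≤ 2 / (N + 1) := by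
  unfold cutoff
  rw [max_comm 0, max_comm 0]
  refine (abs_max_sub_max_le_abs _ _ _).trans ?_
  have h1 : (1 - ((m + n : ℕ) : ℝ) / (N + 1)) - (1 - ((m + 1 + (n + 1) : ℕ) : ℝ) / (N + 1)) =
      2 / (N + 1) := by
    push_cast
    field_simp
    ring
  rw [h1, abs_of_nonneg (by positivity)]

/-- A convergent sum of diagonal differences `U (m+1, n+1) - U (m, n)` vanishes if `U` vanishes on
the boundary and grows at most linearly against a summable weight. The cutoff makes summation by
parts possible, and its slope compensates the linear growth. -/
theorem telescoping_sum_eq_zero {U : ℕ × ℕ → ℂ} {w : ℕ × ℕ → ℝ} (hw : Summable w)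
    (hfst : ∀ n, U (0, n) = 0) (hsnd : ∀ m, U (m, 0) = 0)
    (hU : ∀ m n, ‖U (m + 1, n + 1)‖ ≤ (m + n + 2) * w (m, n)) {D : ℂ}
    (hD : HasSum (fun i : ℕ × ℕ => U (i.1 + 1, i.2 + 1) - U i) D) : D = 0 := by
  have hw0 : ∀ i, 0 ≤ w i := fun i => by
    have h1 := (norm_nonneg _).trans (hU i.1 i.2)
    exact nonneg_of_mul_nonneg_right h1 (by positivity)
  have hfin : ∀ N, {i : ℕ × ℕ | i.1 + i.2 < N + 1}.Finite := fun N =>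
    (Set.finite_Iic ((N, N) : ℕ × ℕ)).subset fun i hi => by
      simp only [Set.mem_ofPred_eq] at hi
      exact ⟨by change i.1 ≤ N; omega, by change i.2 ≤ N; omega⟩
  -- the cut off sums converge to the sum
  have h1 : Filter.Tendsto
      (fun N => ∑' i : ℕ × ℕ, (cutoff N i : ℂ) * (U (i.1 + 1, i.2 + 1) - U i))
      Filter.atTop (nhds D) := by
    rw [← hD.tsum_eq]
    refine tendsto_tsum_of_dominated_convergence hD.summable.norm (fun i => ?_)
      (Filter.Eventually.of_forall fun N i => ?_)
    · have h2 := ((Complex.continuous_ofReal.tendsto 1).comp (tendsto_cutoff i)).mul_const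
        (U (i.1 + 1, i.2 + 1) - U i)
      simpa using h2
    · rw [norm_mul, Complex.norm_real, Real.norm_of_nonneg (cutoff_nonneg N i)]
      exact mul_le_of_le_one_left (norm_nonneg _) (cutoff_le_one N i)
  -- summation by parts
  have h2 : ∀ N, ∑' i : ℕ × ℕ, (cutoff N i : ℂ) * (U (i.1 + 1, i.2 + 1) - U i) =
      ∑' i : ℕ × ℕ, ((cutoff N i - cutoff N (i.1 + 1, i.2 + 1) : ℝ) : ℂ) *
        U (i.1 + 1, i.2 + 1) := by
    intro N
    have hs : ∀ F : ℕ × ℕ → ℂ, Summable fun i => (cutoff N i : ℂ) * F i := fun F =>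
      summable_of_hasFiniteSupport <| (hfin N).subset fun i hi => by
        by_contra h3
        exact hi (by simp [cutoff_eq_zero (not_lt.1 h3)])
    have hs' : ∀ F : ℕ × ℕ → ℂ, Summable fun i => (cutoff N (i.1 + 1, i.2 + 1) : ℂ) * F i :=
      fun F => summable_of_hasFiniteSupport <| (hfin N).subset fun i hi => by
        by_contra h3
        simp only [Set.mem_ofPred_eq] at h3
        have h4 : cutoff N (i.1 + 1, i.2 + 1) = 0 := cutoff_eq_zero (by simp only; omega)
        exact hi (by simp [h4])
    have hinj : Function.Injective fun i : ℕ × ℕ => (i.1 + 1, i.2 + 1) := by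
      rintro ⟨a, b⟩ ⟨c, d⟩ h3
      simpa using h3
    have hshift : ∑' i : ℕ × ℕ, (cutoff N (i.1 + 1, i.2 + 1) : ℂ) * U (i.1 + 1, i.2 + 1) =
        ∑' i : ℕ × ℕ, (cutoff N i : ℂ) * U i := by
      refine hinj.tsum_eq (f := fun i => (cutoff N i : ℂ) * U i) ?_
      rintro ⟨_ | m, _ | n⟩ hi
      · simp [hfst] at hi
      · simp [hfst] at hi
      · simp [hsnd] at hi
      · exact ⟨(m, n), rfl⟩
    simp only [mul_sub, Complex.ofReal_sub, sub_mul]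
    rw [(hs fun i => U (i.1 + 1, i.2 + 1)).tsum_sub (hs U),
      (hs fun i => U (i.1 + 1, i.2 + 1)).tsum_sub (hs' fun i => U (i.1 + 1, i.2 + 1)), hshift]
  have h3 : Filter.Tendsto (fun N => ∑' i : ℕ × ℕ,
      ((cutoff N i - cutoff N (i.1 + 1, i.2 + 1) : ℝ) : ℂ) * U (i.1 + 1, i.2 + 1))
      Filter.atTop (nhds (∑' _ : ℕ × ℕ, (0 : ℂ))) := by
    refine tendsto_tsum_of_dominated_convergence (hw.mul_left 4) (fun i => ?_)
      (Filter.Eventually.of_forall fun N i => ?_)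
    · have h4 := ((Complex.continuous_ofReal.tendsto _).comp
        ((tendsto_cutoff i).sub (tendsto_cutoff (i.1 + 1, i.2 + 1)))).mul_const
        (U (i.1 + 1, i.2 + 1))
      simpa using h4
    · obtain ⟨m, n⟩ := i
      rw [norm_mul, Complex.norm_real, Real.norm_eq_abs]
      by_cases hN : N + 1 ≤ m + n
      · rw [cutoff_eq_zero hN, cutoff_eq_zero (by simp only; omega)]
        simpa using hw0 (m, n)
      · have h5 : ((m + n : ℕ) : ℝ) ≤ N := by exact_mod_cast (by omega)
        push_cast at h5
        calc |cutoff N (m, n) - cutoff N (m + 1, n + 1)| * ‖U (m + 1, n + 1)‖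
            ≤ 2 / (N + 1) * ((m + n + 2) * w (m, n)) := by
              gcongr
              · exact abs_cutoff_sub_le N m n
              · exact hU m n
          _ ≤ 2 / (N + 1) * ((2 * (N + 1)) * w (m, n)) := by
              have := hw0 (m, n)
              gcongr
              linarith
          _ = 4 * w (m, n) := by
              field_simp
              ring
  simp only [h2] at h1
  rw [tsum_zero] at h3
  exact tendsto_nhds_unique h1 h3

/-! ### The domain and its Hermite basis -/

theorem fockSpan_bosons_eq :
    fockSpan opAs opBs vacuum = fockSpan mulX mulY vacuum := by
  obtain ⟨hA, hA', hB, hB'⟩ := isTwoMode_bosons.invariant opA_vacuum opB_vacuum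
  obtain ⟨hX, hX', hY, hY'⟩ := isTwoMode_coordinates.invariant (v := vacuum)
    (by simp [opA_vacuum]) (by simp [opB_vacuum])
  refine le_antisymm (fockSpan_le (vacuum_mem_fockSpan _ _ _) (fun f hf => ?_) (fun f hf => ?_))
    (fockSpan_le (vacuum_mem_fockSpan _ _ _) (fun f hf => ?_) (fun f hf => ?_))
  · have h : opAs f = (2 : ℂ) • mulX f - (1 / 2 : ℂ) • ((2 : ℂ) • opA) f := by
      simp only [opA, opAs, LinearMap.add_apply, LinearMap.sub_apply, LinearMap.smul_apply]
      module
    rw [h]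
    exact Submodule.sub_mem _ (Submodule.smul_mem _ _ (hX' f hf)) (Submodule.smul_mem _ _ (hX f hf))
  · have h : opBs f = (2 : ℂ) • mulY f - (1 / 2 : ℂ) • ((2 : ℂ) • opB) f := by
      simp only [opB, opBs, LinearMap.add_apply, LinearMap.sub_apply, LinearMap.smul_apply]
      module
    rw [h]
    exact Submodule.sub_mem _ (Submodule.smul_mem _ _ (hY' f hf)) (Submodule.smul_mem _ _ (hY f hf))
  · have h : mulX f = (1 / 2 : ℂ) • (opA f + opAs f) := by
      simp only [opA, opAs, LinearMap.add_apply, LinearMap.sub_apply, LinearMap.smul_apply]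
      module
    rw [h]
    exact Submodule.smul_mem _ _ (Submodule.add_mem _ (hA f hf) (hA' f hf))
  · have h : mulY f = (1 / 2 : ℂ) • (opB f + opBs f) := by
      simp only [opB, opBs, LinearMap.add_apply, LinearMap.sub_apply, LinearMap.smul_apply]
      module
    rw [h]
    exact Submodule.smul_mem _ _ (Submodule.add_mem _ (hB f hf) (hB' f hf))

theorem gaussPoly_eq_fockSpan : gaussPoly = fockSpan opAs opBs vacuum := by
  rw [fockSpan_bosons_eq]
  obtain ⟨-, hX, -, hY⟩ := isTwoMode_coordinates.invariant (v := vacuum)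
    (by simp [opA_vacuum]) (by simp [opB_vacuum])
  refine le_antisymm ?_ (fockSpan_le ⟨1, fun x y => ?_⟩ ?_ ?_)
  · have key : ∀ q : MvPolynomial (Fin 2) ℂ, ∃ g ∈ fockSpan mulX mulY vacuum, ∀ x y : ℝ,
        g (x, y) = MvPolynomial.eval ![(x : ℂ), (y : ℂ)] q * (Real.exp (-(x ^ 2 + y ^ 2)) : ℂ) := by
      intro q
      induction q using MvPolynomial.induction_on with
      | C z =>
        refine ⟨z • vacuum, Submodule.smul_mem _ _ (vacuum_mem_fockSpan _ _ _), fun x y => ?_⟩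
        rw [smul_apply, vacuum_apply, MvPolynomial.eval_C, smul_eq_mul]
      | add q r hq hr =>
        obtain ⟨g, hg, hgq⟩ := hq
        obtain ⟨k, hk, hkr⟩ := hr
        refine ⟨g + k, Submodule.add_mem _ hg hk, fun x y => ?_⟩
        rw [add_apply, hgq, hkr, map_add, add_mul]
      | mul_X q j hq =>
        obtain ⟨g, hg, hgq⟩ := hq
        fin_cases j
        · refine ⟨mulX g, hX g hg, fun x y => ?_⟩
          rw [mulX_apply, hgq]
          simp
          ring
        · refine ⟨mulY g, hY g hg, fun x y => ?_⟩
          rw [mulY_apply, hgq]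
          simp
          ring
    rintro f ⟨q, hq⟩
    obtain ⟨g, hg, hgq⟩ := key q
    have hfg : f = g := by
      ext ⟨x, y⟩
      rw [hq, hgq]
    rwa [hfg]
  · rw [vacuum_apply, map_one, one_mul]
  · rintro f ⟨q, hq⟩
    refine ⟨MvPolynomial.X 0 * q, fun x y => ?_⟩
    rw [mulX_apply, hq]
    simp [mul_assoc]
  · rintro f ⟨q, hq⟩
    refine ⟨MvPolynomial.X 1 * q, fun x y => ?_⟩
    rw [mulY_apply, hq]
    simp [mul_assoc]

/-- A space of Schwartz functions that contains all polynomial multiples of a Gaussian is dense. -/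
theorem topologicalClosure_map_toL2 {W : Submodule ℂ Sch} (α : ℝ) (hα : |α| < 1)
    (hv : squeezed α hα ∈ W) (hX : ∀ f ∈ W, mulX f ∈ W) (hY : ∀ f ∈ W, mulY f ∈ W) :
    (W.map toL2).topologicalClosure = ⊤ := by
  rw [Submodule.topologicalClosure_eq_top_iff, Submodule.eq_bot_iff]
  intro f hf
  refine eq_zero_of_inner_fockSpan_coordinates α hα f fun g hg => ?_
  rw [Submodule.mem_orthogonal'] at hf
  exact hf _ (Submodule.mem_map_of_mem (fockSpan_le hv hX hY hg))

theorem topologicalClosure_gaussPoly : (gaussPoly.map toL2).topologicalClosure = ⊤ := by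
  rw [gaussPoly_eq_fockSpan, fockSpan_bosons_eq]
  obtain ⟨-, hX, -, hY⟩ := isTwoMode_coordinates.invariant (v := vacuum)
    (by simp [opA_vacuum]) (by simp [opB_vacuum])
  exact topologicalClosure_map_toL2 0 (by simp) (vacuum_mem_fockSpan mulX mulY vacuum) hX hY

theorem dense_domain_onGaussPoly (T : Op) : Dense ((onGaussPoly T).domain : Set L2) :=
  Submodule.dense_iff_topologicalClosure_eq_top.2 topologicalClosure_gaussPoly

theorem inner_fock_bosons (i j : ℕ × ℕ) :
    inner ℂ (toL2 (fock opAs opBs vacuum i)) (toL2 (fock opAs opBs vacuum j)) =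
      if i = j then (((i.1.factorial * i.2.factorial : ℕ) : ℝ) : ℂ) * (‖toL2 vacuum‖ : ℂ) ^ 2
      else 0 := by
  obtain ⟨m, n⟩ := i
  obtain ⟨p, q⟩ := j
  rw [isTwoMode_bosons.inner_fock_fock isTwoMode_bosons opA_vacuum opB_vacuum opA_vacuum opB_vacuum
    isFormalAdjoint_opA isFormalAdjoint_opA.symm isFormalAdjoint_opB isFormalAdjoint_opB.symm,
    inner_self_eq_norm_sq_to_K]
  simp only [Prod.mk.injEq]
  rfl

theorem toL2_ne_zero {f : Sch} {p : ℝ × ℝ} (h : f p ≠ 0) : toL2 f ≠ 0 := by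
  intro h1
  have h2 : f = 0 := toL2_injective (h1.trans (map_zero toL2).symm)
  exact h (by rw [h2]; rfl)

theorem toL2_vacuum_ne_zero : toL2 vacuum ≠ 0 := toL2_ne_zero (squeezed_ne_zero 0 (by simp) (0, 0))

/-- The norm of an occupation number state of the bosons. -/
def fockNorm (i : ℕ × ℕ) : ℝ := Real.sqrt (i.1.factorial * i.2.factorial : ℕ) * ‖toL2 vacuum‖

theorem fockNorm_pos (i : ℕ × ℕ) : 0 < fockNorm i := by
  have h1 : 0 < ‖toL2 vacuum‖ := norm_pos_iff.2 toL2_vacuum_ne_zero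
  have h2 : (0 : ℝ) < (i.1.factorial * i.2.factorial : ℕ) := by
    exact_mod_cast Nat.mul_pos (Nat.factorial_pos _) (Nat.factorial_pos _)
  exact mul_pos (Real.sqrt_pos.2 h2) h1

theorem fockNorm_ne_zero (i : ℕ × ℕ) : (fockNorm i : ℂ) ≠ 0 := by
  exact_mod_cast (fockNorm_pos i).ne'

/-- The normalized occupation number states of the bosons: the Hermite functions. -/
def hermite (i : ℕ × ℕ) : Sch := (fockNorm i : ℂ)⁻¹ • fock opAs opBs vacuum i

theorem fock_eq_smul_hermite (i : ℕ × ℕ) :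
    fock opAs opBs vacuum i = (fockNorm i : ℂ) • hermite i := by
  rw [hermite, smul_smul, mul_inv_cancel₀ (fockNorm_ne_zero i), one_smul]

theorem hermite_mem (i : ℕ × ℕ) : hermite i ∈ gaussPoly := by
  rw [gaussPoly_eq_fockSpan]
  exact Submodule.smul_mem _ _ (fock_mem_fockSpan _ _ _ _)

theorem orthonormal_hermite : Orthonormal ℂ fun i => toL2 (hermite i) := by
  rw [orthonormal_iff_ite]
  intro i j
  simp only [hermite, map_smul, inner_smul_left, inner_smul_right, inner_fock_bosons]
  by_cases hij : i = j
  · subst hij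
    have h1 := fockNorm_ne_zero i
    have h2 : (((i.1.factorial * i.2.factorial : ℕ) : ℝ) : ℂ) * (‖toL2 vacuum‖ : ℂ) ^ 2 =
        (fockNorm i : ℂ) ^ 2 := by
      rw [fockNorm, Complex.ofReal_mul, mul_pow, ← Complex.ofReal_pow (Real.sqrt _),
        Real.sq_sqrt (Nat.cast_nonneg _)]
    rw [if_pos rfl, if_pos rfl, h2, map_inv₀, Complex.conj_ofReal]
    field_simp
  · simp [hij]

theorem gaussPoly_eq_span_hermite : gaussPoly = Submodule.span ℂ (Set.range hermite) := by
  refine le_antisymm ?_ (Submodule.span_le.2 ?_)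
  · rw [gaussPoly_eq_fockSpan]
    refine Submodule.span_le.2 ?_
    rintro _ ⟨i, rfl⟩
    rw [fock_eq_smul_hermite]
    exact Submodule.smul_mem _ _ (Submodule.subset_span ⟨i, rfl⟩)
  · rintro _ ⟨i, rfl⟩
    exact hermite_mem i

theorem map_gaussPoly_eq_span :
    gaussPoly.map toL2 = Submodule.span ℂ (Set.range fun i => toL2 (hermite i)) := by
  rw [gaussPoly_eq_span_hermite, Submodule.map_span, ← Set.range_comp]
  rfl

/-- The Hermite functions as an orthonormal basis of `L²(ℝ²)`. -/
def hermiteBasis : HilbertBasis (ℕ × ℕ) ℂ L2 :=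
  HilbertBasis.mk orthonormal_hermite
    (by rw [← map_gaussPoly_eq_span, topologicalClosure_gaussPoly])

theorem hermiteBasis_apply (i : ℕ × ℕ) : hermiteBasis i = toL2 (hermite i) :=
  congrFun (HilbertBasis.coe_mk _ _) i

theorem fockNorm_succ_fst (m n : ℕ) :
    fockNorm (m + 1, n) = Real.sqrt (m + 1 : ℕ) * fockNorm (m, n) := by
  rw [fockNorm, fockNorm, ← mul_assoc, ← Real.sqrt_mul (Nat.cast_nonneg _), ← Nat.cast_mul,
    Nat.factorial_succ, mul_assoc]

theorem fockNorm_succ_snd (m n : ℕ) :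
    fockNorm (m, n + 1) = Real.sqrt (n + 1 : ℕ) * fockNorm (m, n) := by
  rw [fockNorm, fockNorm, ← mul_assoc, ← Real.sqrt_mul (Nat.cast_nonneg _), ← Nat.cast_mul,
    Nat.factorial_succ, mul_left_comm]

theorem sqrt_succ_ne_zero (m : ℕ) : (Real.sqrt (m + 1 : ℕ) : ℂ) ≠ 0 := by
  have : 0 < Real.sqrt (m + 1 : ℕ) := Real.sqrt_pos.2 (by positivity)
  exact_mod_cast this.ne'

theorem sqrt_natCast_sq (m : ℕ) : (Real.sqrt (m : ℕ) : ℂ) ^ 2 = m := by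
  rw [← Complex.ofReal_pow, Real.sq_sqrt (Nat.cast_nonneg _), Complex.ofReal_natCast]

theorem opAs_hermite (m n : ℕ) :
    opAs (hermite (m, n)) = (Real.sqrt (m + 1 : ℕ) : ℂ) • hermite (m + 1, n) := by
  rw [hermite, hermite, map_smul, raise_fst_fock, smul_smul, fockNorm_succ_fst]
  have := sqrt_succ_ne_zero m
  push_cast at this ⊢
  congr 1
  field_simp

theorem opBs_hermite (m n : ℕ) :
    opBs (hermite (m, n)) = (Real.sqrt (n + 1 : ℕ) : ℂ) • hermite (m, n + 1) := by
  rw [hermite, hermite, map_smul, isTwoMode_bosons.raise_snd_fock, smul_smul, fockNorm_succ_snd]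
  have := sqrt_succ_ne_zero n
  push_cast at this ⊢
  congr 1
  field_simp

theorem opA_hermite (m n : ℕ) :
    opA (hermite (m, n)) = (Real.sqrt (m : ℕ) : ℂ) • hermite (m - 1, n) := by
  rw [hermite, hermite, map_smul, isTwoMode_bosons.lower_fst_fock opA_vacuum, smul_smul, smul_smul]
  rcases m with _ | m
  · simp
  · rw [Nat.add_sub_cancel, fockNorm_succ_fst]
    have h1 := sqrt_succ_ne_zero m
    have h2 := sqrt_natCast_sq (m + 1)
    rw [← h2]
    push_cast at h1 ⊢
    congr 1
    field_simp

theorem opB_hermite (m n : ℕ) :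
    opB (hermite (m, n)) = (Real.sqrt (n : ℕ) : ℂ) • hermite (m, n - 1) := by
  rw [hermite, hermite, map_smul, isTwoMode_bosons.lower_snd_fock opB_vacuum, smul_smul, smul_smul]
  rcases n with _ | n
  · simp
  · rw [Nat.add_sub_cancel, fockNorm_succ_snd]
    have h1 := sqrt_succ_ne_zero n
    have h2 := sqrt_natCast_sq (n + 1)
    rw [← h2]
    push_cast at h1 ⊢
    congr 1
    field_simp

/-- The matrix of the Hamiltonian in the Hermite basis couples an occupation number only to its
diagonal neighbours. The truncated subtraction in `m - 1`, `n - 1` is harmless, because the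
coefficient vanishes at the boundary. -/
theorem hamOp_hermite (β γ : ℝ) (m n : ℕ) :
    hamOp β γ (hermite (m, n)) = ((m + n + 1 + β * (m - n) : ℝ) : ℂ) • hermite (m, n) +
      (γ : ℂ) • ((Real.sqrt (m + 1 : ℕ) * Real.sqrt (n + 1 : ℕ) : ℂ) • hermite (m + 1, n + 1) -
        (Real.sqrt m * Real.sqrt n : ℂ) • hermite (m - 1, n - 1)) := by
  have h1 : opAs (opA (hermite (m, n))) = (m : ℂ) • hermite (m, n) := by
    rw [opA_hermite, map_smul, opAs_hermite, smul_smul]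
    rcases m with _ | m
    · simp
    · rw [Nat.add_sub_cancel, ← sq, sqrt_natCast_sq]
  have h2 : opBs (opB (hermite (m, n))) = (n : ℂ) • hermite (m, n) := by
    rw [opB_hermite, map_smul, opBs_hermite, smul_smul]
    rcases n with _ | n
    · simp
    · rw [Nat.add_sub_cancel, ← sq, sqrt_natCast_sq]
  rw [hamOp, opB_opBs]
  simp only [LinearMap.add_apply, LinearMap.sub_apply, LinearMap.smul_apply, Module.End.mul_apply,
    Module.End.one_apply]
  rw [h1, h2]
  simp only [opBs_hermite, opB_hermite, map_smul, opAs_hermite, opA_hermite, smul_smul]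
  push_cast
  module

/-! ### The adjoint of the Hamiltonian -/

theorem mem_adjoint_graph_onGaussPoly {T : Op} {v v' : L2} :
    (v, v') ∈ (onGaussPoly T).graph.adjoint ↔
      ∀ f ∈ gaussPoly, inner ℂ v' (toL2 f) = inner ℂ v (toL2 (T f)) := by
  rw [Submodule.mem_adjoint_iff]
  constructor
  · intro h f hf
    have h1 := h _ _ ((mem_graph_onGaussPoly T _ _).2 ⟨f, hf, rfl, rfl⟩)
    rw [← inner_conj_symm, ← inner_conj_symm v, ← sub_eq_zero.1 h1]
  · intro h a b hab
    obtain ⟨f, hf, rfl, rfl⟩ := (mem_graph_onGaussPoly T _ _).1 hab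
    have h1 := h f hf
    rw [← inner_conj_symm, ← h1, inner_conj_symm, sub_self]

/-- The maximal operators of the Hamiltonian and of its formal adjoint are adjoint to each other. In
the Hermite basis, the difference of the two forms is a sum of diagonal differences. -/
theorem inner_adjoint_hamOp (β γ : ℝ) {v v' f f' : L2}
    (hv : (v, v') ∈ (onGaussPoly (hamOp β (-γ))).graph.adjoint)
    (hf : (f, f') ∈ (onGaussPoly (hamOp β γ)).graph.adjoint) :
    inner ℂ v' f = inner ℂ v f' := by
  rw [mem_adjoint_graph_onGaussPoly] at hv hf
  set V : ℕ × ℕ → ℂ := fun i => inner ℂ v (toL2 (hermite i)) with hV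
  set F : ℕ × ℕ → ℂ := fun i => inner ℂ (toL2 (hermite i)) f with hF
  -- the pair terms contribute `U (m + 1, n + 1) - U (m, n)` to the difference of the two forms
  set U : ℕ × ℕ → ℂ := fun i => -γ * ((Real.sqrt i.1 * Real.sqrt i.2) *
    (V i * F (i.1 - 1, i.2 - 1) + V (i.1 - 1, i.2 - 1) * F i)) with hU
  have hv' : ∀ m n : ℕ, inner ℂ v' (toL2 (hermite (m, n))) =
      ((m + n + 1 + β * (m - n) : ℝ) : ℂ) * V (m, n) -
      (γ : ℂ) * ((Real.sqrt (m + 1 : ℕ) * Real.sqrt (n + 1 : ℕ) : ℂ) * V (m + 1, n + 1) -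
        (Real.sqrt m * Real.sqrt n : ℂ) * V (m - 1, n - 1)) := by
    intro m n
    rw [hv _ (hermite_mem _), hamOp_hermite]
    simp only [map_add, map_smul, map_sub, inner_add_right, inner_smul_right, inner_sub_right, hV]
    push_cast
    ring
  have hf' : ∀ m n : ℕ, inner ℂ (toL2 (hermite (m, n))) f' =
      ((m + n + 1 + β * (m - n) : ℝ) : ℂ) * F (m, n) +
      (γ : ℂ) * ((Real.sqrt (m + 1 : ℕ) * Real.sqrt (n + 1 : ℕ) : ℂ) * F (m + 1, n + 1) -
        (Real.sqrt m * Real.sqrt n : ℂ) * F (m - 1, n - 1)) := by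
    intro m n
    rw [← inner_conj_symm, hf _ (hermite_mem _), inner_conj_symm, hamOp_hermite]
    simp only [map_add, map_smul, map_sub, inner_add_left, inner_smul_left, inner_sub_left, hF,
      map_mul, Complex.conj_ofReal]
  have hsum : HasSum (fun i : ℕ × ℕ => U (i.1 + 1, i.2 + 1) - U i)
      (inner ℂ v' f - inner ℂ v f') := by
    have h1 := (hermiteBasis.hasSum_inner_mul_inner v' f).sub
      (hermiteBasis.hasSum_inner_mul_inner v f')
    have h2 : (fun i : ℕ × ℕ => U (i.1 + 1, i.2 + 1) - U i) = fun i =>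
        inner ℂ v' (hermiteBasis i) * inner ℂ (hermiteBasis i) f -
          inner ℂ v (hermiteBasis i) * inner ℂ (hermiteBasis i) f' := by
      refine funext fun ⟨m, n⟩ => ?_
      rw [hermiteBasis_apply, hv', hf']
      simp only [hU, hV, hF, Nat.add_sub_cancel]
      ring
    rw [h2]
    exact h1
  have hVs : Summable fun i => ‖V i‖ ^ 2 := by
    simp only [hV, norm_inner_symm v]
    exact orthonormal_hermite.inner_products_summable v
  have hFs : Summable fun i => ‖F i‖ ^ 2 := orthonormal_hermite.inner_products_summable f
  have hinj : Function.Injective fun i : ℕ × ℕ => (i.1 + 1, i.2 + 1) := by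
    rintro ⟨a, b⟩ ⟨c, d⟩ h3
    simpa using h3
  refine sub_eq_zero.1 (telescoping_sum_eq_zero (U := U)
    (w := fun i => |γ| * (‖V (i.1 + 1, i.2 + 1)‖ * ‖F i‖ + ‖V i‖ * ‖F (i.1 + 1, i.2 + 1)‖))
    ?_ ?_ ?_ ?_ hsum)
  · refine Summable.mul_left _ (Summable.of_nonneg_of_le (fun i => by positivity) (fun i => ?_)
      (((hVs.comp_injective hinj).add hFs).add (hVs.add (hFs.comp_injective hinj))))
    have h1 := two_mul_le_add_sq ‖V (i.1 + 1, i.2 + 1)‖ ‖F i‖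
    have h2 := two_mul_le_add_sq ‖V i‖ ‖F (i.1 + 1, i.2 + 1)‖
    simp only [Function.comp_apply]
    nlinarith [norm_nonneg (V (i.1 + 1, i.2 + 1)), norm_nonneg (F i), norm_nonneg (V i),
      norm_nonneg (F (i.1 + 1, i.2 + 1)),
      mul_nonneg (norm_nonneg (V (i.1 + 1, i.2 + 1))) (norm_nonneg (F i)),
      mul_nonneg (norm_nonneg (V i)) (norm_nonneg (F (i.1 + 1, i.2 + 1)))]
  · intro n
    simp [hU]
  · intro m
    simp [hU]
  · intro m n
    have h1 : Real.sqrt (m + 1 : ℕ) * Real.sqrt (n + 1 : ℕ) ≤ m + n + 2 := by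
      have h2 := two_mul_le_add_sq (Real.sqrt (m + 1 : ℕ)) (Real.sqrt (n + 1 : ℕ))
      rw [Real.sq_sqrt (Nat.cast_nonneg _), Real.sq_sqrt (Nat.cast_nonneg _)] at h2
      push_cast at h2 ⊢
      nlinarith [mul_nonneg (Real.sqrt_nonneg ((m : ℝ) + 1)) (Real.sqrt_nonneg ((n : ℝ) + 1))]
    simp only [hU, Nat.add_sub_cancel]
    rw [norm_mul, norm_mul, norm_neg, ← Complex.ofReal_mul, Complex.norm_real, Complex.norm_real,
      Real.norm_eq_abs, Real.norm_of_nonneg (by positivity), mul_left_comm, ← norm_mul, ← norm_mul]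
    gcongr
    exact norm_add_le _ _

theorem onGaussPoly_hamOp_le_adjoint (β γ : ℝ) :
    onGaussPoly (hamOp β (-γ)) ≤ (onGaussPoly (hamOp β γ)).adjoint := by
  refine LinearPMap.le_of_le_graph ?_
  rw [LinearPMap.adjoint_graph_eq_graph_adjoint (dense_domain_onGaussPoly _)]
  rintro ⟨u, u'⟩ hu
  obtain ⟨f, -, rfl, rfl⟩ := (mem_graph_onGaussPoly _ _ _).1 hu
  rw [mem_adjoint_graph_onGaussPoly]
  exact fun g _ => ((isFormalAdjoint_hamOp β γ).symm f g)

/-- The Hamiltonian with the opposite coupling constant is the full adjoint. -/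
theorem adjoint_onGaussPoly_hamOp (β γ : ℝ) :
    (onGaussPoly (hamOp β γ)).adjoint = ham β (-γ) :=
  adjoint_eq_closure (dense_domain_onGaussPoly _) (onGaussPoly_hamOp_le_adjoint β γ)
    fun _ _ _ _ hv hf => inner_adjoint_hamOp β γ hv hf

theorem isClosable_hamOp (β γ : ℝ) : (onGaussPoly (hamOp β γ)).IsClosable := by
  have h := onGaussPoly_hamOp_le_adjoint β (-γ)
  rw [neg_neg] at h
  exact (LinearPMap.adjoint_isClosed (dense_domain_onGaussPoly _)).isClosable.leIsClosable h

theorem dense_domain_ham (β γ : ℝ) : Dense ((ham β γ).domain : Set L2) :=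
  (dense_domain_onGaussPoly _).mono (LinearPMap.le_closure _).1

theorem adjoint_ham (β γ : ℝ) : (ham β γ).adjoint = ham β (-γ) := by
  rw [ham, adjoint_closure (dense_domain_onGaussPoly _) (isClosable_hamOp β γ),
    adjoint_onGaussPoly_hamOp]

/-- The closed Hamiltonian acts on all Schwartz functions by the differential expression. -/
theorem toL2_mem_graph_ham (β γ : ℝ) (f : Sch) :
    (toL2 f, toL2 (hamOp β γ f)) ∈ (ham β γ).graph := by
  have h := adjoint_onGaussPoly_hamOp β (-γ)
  rw [neg_neg] at h
  rw [← h, LinearPMap.adjoint_graph_eq_graph_adjoint (dense_domain_onGaussPoly _),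
    mem_adjoint_graph_onGaussPoly]
  exact fun g _ => isFormalAdjoint_hamOp β γ f g

/-! ### Criteria for eigenvalues and completeness -/

/-- An operator whose adjoint has a complete system of eigenvectors for real eigenvalues has no
other eigenvalues: an eigenvector for another one would be orthogonal to the system. -/
theorem eigenvalues_subset_range {E ι : Type*} [NormedAddCommGroup E] [InnerProductSpace ℂ E]
    [CompleteSpace E] {T : E →ₗ.[ℂ] E} (hT : Dense (T.domain : Set E)) {e : ι → ℝ} {w : ι → E}
    (hw : ∀ i, IsEigenvector T.adjoint (e i) (w i)) (hc : IsCompleteSystem w) :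
    eigenvalues T ⊆ Set.range fun i => (e i : ℂ) := by
  rintro z ⟨v, hv0, hv⟩
  by_contra hz
  rw [IsCompleteSystem, Submodule.topologicalClosure_eq_top_iff] at hc
  refine hv0 ((Submodule.mem_bot ℂ).1 (hc ▸ ?_))
  rw [Submodule.mem_orthogonal']
  intro u hu
  induction hu using Submodule.span_induction with
  | mem u hu =>
    obtain ⟨i, rfl⟩ := hu
    have h1 := (hw i).2
    rw [LinearPMap.adjoint_graph_eq_graph_adjoint hT, Submodule.mem_adjoint_iff] at h1
    have h2 := h1 _ _ hv
    simp only [inner_smul_left, inner_smul_right] at h2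
    rw [← sub_mul] at h2
    refine (mul_eq_zero.1 h2).resolve_left fun h3 => hz ⟨i, ?_⟩
    have h4 := congrArg (starRingEnd ℂ) (sub_eq_zero.1 h3)
    simpa using h4.symm
  | zero => simp
  | add a b _ _ ha hb => rw [inner_add_right, ha, hb, add_zero]
  | smul c a _ ha => rw [inner_smul_right, ha, mul_zero]

/-- The occupation number states are complete in `L²(ℝ²)` if their span is invariant under the
bosonic operators and the vacuum is a Gaussian. -/
theorem isCompleteSystem_fock {A' B' : Op} (α : ℝ) (hα : |α| < 1)
    (hA : ∀ f ∈ fockSpan A' B' (squeezed α hα), opA f ∈ fockSpan A' B' (squeezed α hα))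
    (hA' : ∀ f ∈ fockSpan A' B' (squeezed α hα), opAs f ∈ fockSpan A' B' (squeezed α hα))
    (hB : ∀ f ∈ fockSpan A' B' (squeezed α hα), opB f ∈ fockSpan A' B' (squeezed α hα))
    (hB' : ∀ f ∈ fockSpan A' B' (squeezed α hα), opBs f ∈ fockSpan A' B' (squeezed α hα)) :
    IsCompleteSystem fun i => toL2 (fock A' B' (squeezed α hα) i) := by
  have h1 : Submodule.span ℂ (Set.range fun i => toL2 (fock A' B' (squeezed α hα) i)) =
      (fockSpan A' B' (squeezed α hα)).map toL2 := by
    rw [fockSpan, Submodule.map_span, ← Set.range_comp]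
    rfl
  rw [IsCompleteSystem, h1]
  refine topologicalClosure_map_toL2 α hα (vacuum_mem_fockSpan _ _ _) (fun f hf => ?_)
    (fun f hf => ?_)
  · have h : mulX f = (1 / 2 : ℂ) • (opA f + opAs f) := by
      simp only [opA, opAs, LinearMap.add_apply, LinearMap.sub_apply, LinearMap.smul_apply]
      module
    rw [h]
    exact Submodule.smul_mem _ _ (Submodule.add_mem _ (hA f hf) (hA' f hf))
  · have h : mulY f = (1 / 2 : ℂ) • (opB f + opBs f) := by
      simp only [opB, opBs, LinearMap.add_apply, LinearMap.sub_apply, LinearMap.smul_apply]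
      module
    rw [h]
    exact Submodule.smul_mem _ _ (Submodule.add_mem _ (hB f hf) (hB' f hf))

/-! ### Bosons in terms of pseudo-bosons -/

theorem opA_eq {γ : ℝ} (hγ : γ ≠ 0) :
    opA = normConst γ • (((1 + rho γ : ℝ) : ℂ) • opC γ - ((-1 + rho γ : ℝ) : ℂ) • opDd γ) := by
  have h := normConst_sq hγ
  simp only [opC, opDd]
  push_cast
  match_scalars
  · linear_combination -h
  · ring

theorem opB_eq {γ : ℝ} (hγ : γ ≠ 0) :
    opB = normConst γ • (((1 + rho γ : ℝ) : ℂ) • opD γ - ((-1 + rho γ : ℝ) : ℂ) • opCd γ) := by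
  have h := normConst_sq hγ
  simp only [opD, opCd]
  push_cast
  match_scalars
  · linear_combination -h
  · ring

theorem opAs_eq {γ : ℝ} (hγ : γ ≠ 0) :
    opAs = normConst γ • ((γ : ℂ) • (opD γ + opCd γ)) := by
  have h := normConst_sq hγ
  simp only [opD, opCd]
  push_cast
  match_scalars
  · linear_combination -h
  · ring

theorem opBs_eq {γ : ℝ} (hγ : γ ≠ 0) :
    opBs = normConst γ • ((γ : ℂ) • (opC γ + opDd γ)) := by
  have h := normConst_sq hγ
  simp only [opC, opDd]
  push_cast
  match_scalars
  · linear_combination -h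
  · ring

theorem opAs_eq_dual {γ : ℝ} (hγ : γ ≠ 0) :
    opAs = star (normConst γ) •
      (((1 + rho γ : ℝ) : ℂ) • opCs γ - ((-1 + rho γ : ℝ) : ℂ) • opDds γ) := by
  refine isFormalAdjoint_opA.unique ?_
  rw [opA_eq hγ]
  exact (((isFormalAdjoint_opC γ).real_smul _).sub ((isFormalAdjoint_opDd γ).real_smul _)).smul _

theorem opBs_eq_dual {γ : ℝ} (hγ : γ ≠ 0) :
    opBs = star (normConst γ) •
      (((1 + rho γ : ℝ) : ℂ) • opDs γ - ((-1 + rho γ : ℝ) : ℂ) • opCds γ) := by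
  refine isFormalAdjoint_opB.unique ?_
  rw [opB_eq hγ]
  exact (((isFormalAdjoint_opD γ).real_smul _).sub ((isFormalAdjoint_opCd γ).real_smul _)).smul _

theorem opA_eq_dual {γ : ℝ} (hγ : γ ≠ 0) :
    opA = star (normConst γ) • ((γ : ℂ) • (opDs γ + opCds γ)) := by
  refine isFormalAdjoint_opA.symm.unique ?_
  rw [opAs_eq hγ]
  exact (((isFormalAdjoint_opD γ).add (isFormalAdjoint_opCd γ)).real_smul _).smul _

theorem opB_eq_dual {γ : ℝ} (hγ : γ ≠ 0) :
    opB = star (normConst γ) • ((γ : ℂ) • (opCs γ + opDds γ)) := by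
  refine isFormalAdjoint_opB.symm.unique ?_
  rw [opBs_eq hγ]
  exact (((isFormalAdjoint_opC γ).add (isFormalAdjoint_opDd γ)).real_smul _).smul _

/-! ### Biorthogonal systems of eigenvectors -/

theorem isCompleteSystem_psi {γ : ℝ} (hγ : γ ≠ 0) : IsCompleteSystem (psi γ) := by
  obtain ⟨hC, hC', hD, hD'⟩ :=
    (isTwoMode_pseudoBosons hγ).invariant (opC_psiZero γ) (opD_psiZero γ)
  refine isCompleteSystem_fock (A' := opCd γ) (B' := opDd γ) (alpha γ) (abs_alpha_lt_one γ)
    (fun f hf => ?_) (fun f hf => ?_) (fun f hf => ?_) (fun f hf => ?_)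
  · rw [opA_eq hγ]
    exact Submodule.smul_mem _ _ (Submodule.sub_mem _ (Submodule.smul_mem _ _ (hC f hf))
      (Submodule.smul_mem _ _ (hD' f hf)))
  · rw [opAs_eq hγ]
    exact Submodule.smul_mem _ _ (Submodule.smul_mem _ _
      (Submodule.add_mem _ (hD f hf) (hC' f hf)))
  · rw [opB_eq hγ]
    exact Submodule.smul_mem _ _ (Submodule.sub_mem _ (Submodule.smul_mem _ _ (hD f hf))
      (Submodule.smul_mem _ _ (hC' f hf)))
  · rw [opBs_eq hγ]
    exact Submodule.smul_mem _ _ (Submodule.smul_mem _ _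
      (Submodule.add_mem _ (hC f hf) (hD' f hf)))

theorem isCompleteSystem_psi' {γ : ℝ} (hγ : γ ≠ 0) : IsCompleteSystem (psi' γ) := by
  obtain ⟨hC, hC', hD, hD'⟩ :=
    (isTwoMode_dual hγ).invariant (opCds_psiZero' γ) (opDds_psiZero' γ)
  refine isCompleteSystem_fock (A' := opCs γ) (B' := opDs γ) (-alpha γ)
    (by rw [abs_neg]; exact abs_alpha_lt_one γ)
    (fun f hf => ?_) (fun f hf => ?_) (fun f hf => ?_) (fun f hf => ?_)
  · rw [opA_eq_dual hγ]
    exact Submodule.smul_mem _ _ (Submodule.smul_mem _ _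
      (Submodule.add_mem _ (hD' f hf) (hC f hf)))
  · rw [opAs_eq_dual hγ]
    exact Submodule.smul_mem _ _ (Submodule.sub_mem _ (Submodule.smul_mem _ _ (hC' f hf))
      (Submodule.smul_mem _ _ (hD f hf)))
  · rw [opB_eq_dual hγ]
    exact Submodule.smul_mem _ _ (Submodule.smul_mem _ _
      (Submodule.add_mem _ (hC' f hf) (hD f hf)))
  · rw [opBs_eq_dual hγ]
    exact Submodule.smul_mem _ _ (Submodule.sub_mem _ (Submodule.smul_mem _ _ (hD' f hf))
      (Submodule.smul_mem _ _ (hC f hf)))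

theorem inner_psi_psi' {γ : ℝ} (hγ : γ ≠ 0) (m n p q : ℕ) :
    inner ℂ (psi γ (m, n)) (psi' γ (p, q)) =
      if m = p ∧ n = q then
        ((m.factorial * n.factorial : ℕ) : ℂ) * inner ℂ (toL2 (psiZero γ)) (toL2 (psiZero' γ))
      else 0 :=
  (isTwoMode_pseudoBosons hγ).inner_fock_fock (isTwoMode_dual hγ) (opC_psiZero γ) (opD_psiZero γ)
    (opCds_psiZero' γ) (opDds_psiZero' γ) (isFormalAdjoint_opC γ) (isFormalAdjoint_opCd γ)
    (isFormalAdjoint_opD γ) (isFormalAdjoint_opDd γ) m n p q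

/-- If the vacua were orthogonal, then `Ψ₀'` would be orthogonal to the complete system `psi`. -/
theorem inner_psiZero_ne_zero {γ : ℝ} (hγ : γ ≠ 0) :
    inner ℂ (toL2 (psiZero γ)) (toL2 (psiZero' γ)) ≠ 0 := by
  intro h
  have hc := isCompleteSystem_psi hγ
  rw [IsCompleteSystem, Submodule.topologicalClosure_eq_top_iff] at hc
  have hmem : toL2 (psiZero' γ) ∈ (Submodule.span ℂ (Set.range (psi γ)))ᗮ := by
    rw [Submodule.mem_orthogonal]
    intro u hu
    induction hu using Submodule.span_induction with
    | mem u hu =>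
      obtain ⟨⟨m, n⟩, rfl⟩ := hu
      have h1 := inner_psi_psi' hγ m n 0 0
      rw [h, mul_zero, ite_self] at h1
      simpa [psi'] using h1
    | zero => simp
    | add a b _ _ ha hb => rw [inner_add_left, ha, hb, add_zero]
    | smul c a _ ha => rw [inner_smul_left, ha, mul_zero]
  rw [hc, Submodule.mem_bot] at hmem
  exact toL2_ne_zero (squeezed_ne_zero (-alpha γ) _ (0, 0)) hmem

theorem inner_psi_psi'_eq_zero_iff {γ : ℝ} (hγ : γ ≠ 0) (i j : ℕ × ℕ) :
    inner ℂ (psi γ i) (psi' γ j) = 0 ↔ i ≠ j := by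
  obtain ⟨m, n⟩ := i
  obtain ⟨p, q⟩ := j
  rw [inner_psi_psi' hγ, Ne, Prod.mk.injEq]
  by_cases h : m = p ∧ n = q
  · simp [h, inner_psiZero_ne_zero hγ, Nat.factorial_ne_zero]
  · simp [h]

theorem psi_ne_zero {γ : ℝ} (hγ : γ ≠ 0) (i : ℕ × ℕ) : psi γ i ≠ 0 := fun h =>
  (inner_psi_psi'_eq_zero_iff hγ i i).1 (by rw [h, inner_zero_left]) rfl

theorem psi'_ne_zero {γ : ℝ} (hγ : γ ≠ 0) (i : ℕ × ℕ) : psi' γ i ≠ 0 := fun h =>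
  (inner_psi_psi'_eq_zero_iff hγ i i).1 (by rw [h, inner_zero_right]) rfl

theorem isEigenvector_psi (β : ℝ) {γ : ℝ} (hγ : γ ≠ 0) (i : ℕ × ℕ) :
    IsEigenvector (ham β γ) (energy β γ i) (psi γ i) := by
  refine ⟨psi_ne_zero hγ i, ?_⟩
  have h1 := toL2_mem_graph_ham β γ (fock (opCd γ) (opDd γ) (psiZero γ) i)
  rwa [hamOp_eq β hγ, (isTwoMode_pseudoBosons hγ).energy_fock (opC_psiZero γ) (opD_psiZero γ),
    map_smul] at h1

theorem isEigenvector_psi' (β : ℝ) {γ : ℝ} (hγ : γ ≠ 0) (i : ℕ × ℕ) :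
    IsEigenvector (ham β γ).adjoint (energy β γ i) (psi' γ i) := by
  refine ⟨psi'_ne_zero hγ i, ?_⟩
  rw [adjoint_ham]
  have h1 := toL2_mem_graph_ham β (-γ) (fock (opCs γ) (opDs γ) (psiZero' γ) i)
  rwa [hamOp_neg_eq β hγ, (isTwoMode_dual hγ).energy_fock (opCds_psiZero' γ) (opDds_psiZero' γ),
    map_smul] at h1

theorem eigenvalues_ham (β : ℝ) {γ : ℝ} (hγ : γ ≠ 0) :
    eigenvalues (ham β γ) = Set.range fun i : ℕ × ℕ => (energy β γ i : ℂ) := by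
  refine (eigenvalues_subset_range (dense_domain_ham β γ) (isEigenvector_psi' β hγ)
    (isCompleteSystem_psi' hγ)).antisymm ?_
  rintro _ ⟨i, rfl⟩
  exact ⟨_, isEigenvector_psi β hγ i⟩

theorem eigenvalues_adjoint_ham (β : ℝ) {γ : ℝ} (hγ : γ ≠ 0) :
    eigenvalues (ham β γ).adjoint = Set.range fun i : ℕ × ℕ => (energy β γ i : ℂ) := by
  refine subset_antisymm ?_ ?_
  · rw [adjoint_ham]
    refine eigenvalues_subset_range (dense_domain_ham β (-γ)) (w := psi γ) (fun i => ?_)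
      (isCompleteSystem_psi hγ)
    rw [adjoint_ham, neg_neg]
    exact isEigenvector_psi β hγ i
  · rintro _ ⟨i, rfl⟩
    exact ⟨_, isEigenvector_psi' β hγ i⟩

/-! ### The vacua as exponentials -/

/-- The scalar product with `Φ₀` does not depend on the squeezing parameter. -/
theorem inner_vacuum_squeezed (α : ℝ) (hα : |α| < 1) :
    inner ℂ (toL2 vacuum) (toL2 (squeezed α hα)) = (Real.pi / 2 : ℝ) := by
  have h1 := (sq_lt_one_iff_abs_lt_one α).2 hα
  have hpos : 0 < 1 - α ^ 2 := by linarith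
  set N := (Real.sqrt (1 - α ^ 2))⁻¹ with hN
  set k := 2 / (1 - α ^ 2) with hk
  -- completing the square in the exponent
  have hfun : ∀ p : ℝ × ℝ, squeezed α hα p * star (vacuum p) =
      ((N * (Real.exp (-k * (p.1 + α * p.2) ^ 2) * Real.exp (-2 * p.2 ^ 2)) : ℝ) : ℂ) := by
    rintro ⟨x, y⟩
    rw [squeezed_apply, vacuum_apply, Complex.star_def, Complex.conj_ofReal, ← Complex.ofReal_mul,
      mul_assoc, ← Real.exp_add, ← Real.exp_add]
    congr 3
    simp only [hk]
    field_simp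
    ring
  have hint : Integrable (fun p : ℝ × ℝ =>
      N * (Real.exp (-k * (p.1 + α * p.2) ^ 2) * Real.exp (-2 * p.2 ^ 2))) := by
    have h2 : Integrable fun p : ℝ × ℝ => squeezed α hα p * star (vacuum p) :=
      ((squeezed α hα).memLp 2 volume).integrable_mul (vacuum.memLp 2 volume).star
    simp only [hfun] at h2
    exact h2.re
  rw [inner_toL2]
  simp only [hfun]
  rw [integral_complex_ofReal]
  congr 1
  rw [Measure.volume_eq_prod] at hint ⊢
  rw [integral_prod_symm _ hint]
  have hin : ∀ y : ℝ, ∫ x : ℝ, N * (Real.exp (-k * (x + α * y) ^ 2) * Real.exp (-2 * y ^ 2)) =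
      N * Real.sqrt (Real.pi / k) * Real.exp (-2 * y ^ 2) := by
    intro y
    rw [integral_const_mul, integral_mul_const,
      integral_add_right_eq_self (fun x => Real.exp (-k * x ^ 2)), integral_gaussian, mul_assoc]
  simp only [hin]
  rw [integral_const_mul, integral_gaussian]
  have h3 : Real.pi / k = (1 - α ^ 2) * (Real.pi / 2) := by
    simp only [hk]
    field_simp
  have h4 : Real.sqrt (1 - α ^ 2) ≠ 0 := (Real.sqrt_pos.2 hpos).ne'
  rw [h3, Real.sqrt_mul hpos.le, hN, inv_mul_cancel_left₀ h4,
    Real.mul_self_sqrt (by positivity)]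

/-- The coefficients of a squeezed vacuum: `a Ψ = -α b* Ψ` and `b Ψ = -α a* Ψ` are a recursion for
them. -/
theorem inner_fock_squeezed (α : ℝ) (hα : |α| < 1) (m n : ℕ) :
    inner ℂ (toL2 (fock opAs opBs vacuum (m, n))) (toL2 (squeezed α hα)) =
      if m = n then (-α : ℂ) ^ m * m.factorial * (‖toL2 vacuum‖ : ℂ) ^ 2 else 0 := by
  induction m generalizing n with
  | zero =>
    rcases n with _ | n
    · have h0 : inner ℂ (toL2 vacuum) (toL2 vacuum) = ((Real.pi / 2 : ℝ) : ℂ) :=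
        inner_vacuum_squeezed 0 (by simp)
      rw [fock_zero, inner_vacuum_squeezed, ← h0, inner_self_eq_norm_sq_to_K]
      simp
    · rw [← isTwoMode_bosons.raise_snd_fock, isFormalAdjoint_opB.symm, opB_squeezed, map_smul,
        inner_smul_right, ← isFormalAdjoint_opA, isTwoMode_bosons.lower_fst_fock opA_vacuum]
      simp
  | succ m ih =>
    rw [← raise_fst_fock, isFormalAdjoint_opA.symm, opA_squeezed, map_smul, inner_smul_right,
      ← isFormalAdjoint_opB, isTwoMode_bosons.lower_snd_fock opB_vacuum, map_smul, inner_smul_left]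
    rcases n with _ | n
    · simp
    · rw [Nat.add_sub_cancel, ih]
      by_cases h : m = n
      · subst h
        simp [Nat.factorial_succ, pow_succ]
        ring
      · simp [h]

theorem hasSum_squeezed (α : ℝ) (hα : |α| < 1) :
    HasSum (fun k : ℕ => ((-α : ℂ) ^ k / (k.factorial : ℂ)) •
      toL2 (((opAs * opBs) ^ k) vacuum)) (toL2 (squeezed α hα)) := by
  have hinj : Function.Injective fun k : ℕ => (k, k) := fun a b h => congrArg Prod.fst h
  have h1 := hermiteBasis.hasSum_repr (toL2 (squeezed α hα))
  have hcoef : ∀ m n, hermiteBasis.repr (toL2 (squeezed α hα)) (m, n) =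
      (fockNorm (m, n) : ℂ)⁻¹ * if m = n then
        (-α : ℂ) ^ m * m.factorial * (‖toL2 vacuum‖ : ℂ) ^ 2 else 0 := by
    intro m n
    rw [hermiteBasis.repr_apply_apply, hermiteBasis_apply, hermite, map_smul, inner_smul_left,
      inner_fock_squeezed, map_inv₀, Complex.conj_ofReal]
  rw [← hinj.hasSum_iff] at h1
  · have h2 : (fun k : ℕ => ((-α : ℂ) ^ k / (k.factorial : ℂ)) •
        toL2 (((opAs * opBs) ^ k) vacuum)) =
        (fun i => hermiteBasis.repr (toL2 (squeezed α hα)) i • hermiteBasis i) ∘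
          fun k : ℕ => (k, k) := by
      refine funext fun k => ?_
      have h3 : ((opAs * opBs) ^ k) vacuum = fock opAs opBs vacuum (k, k) := by
        rw [isTwoMode_bosons.commute_raise.mul_pow]
        rfl
      have h4 : fockNorm (k, k) = k.factorial * ‖toL2 vacuum‖ := by
        rw [fockNorm, Nat.cast_mul, Real.sqrt_mul_self (Nat.cast_nonneg _)]
      have h5 : (‖toL2 vacuum‖ : ℂ) ≠ 0 := by
        exact_mod_cast (norm_pos_iff.2 toL2_vacuum_ne_zero).ne'
      have h6 : (k.factorial : ℂ) ≠ 0 := by exact_mod_cast k.factorial_ne_zero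
      simp only [Function.comp_apply]
      rw [hcoef, hermiteBasis_apply, if_pos rfl, h3, fock_eq_smul_hermite, map_smul, smul_smul, h4]
      push_cast
      congr 1
      field_simp
    rw [h2]
    exact h1
  · rintro ⟨m, n⟩ hmn
    have h3 : m ≠ n := fun h => hmn ⟨m, by rw [h]⟩
    rw [hcoef, if_neg h3, mul_zero, zero_smul]

/-! ### Unitary equivalence -/

section Unitary

variable {E : Type*} [NormedAddCommGroup E] [InnerProductSpace ℂ E]

theorem unitaryConj_symm_unitaryConj (S : E ≃ₗᵢ[ℂ] E) (T : E →ₗ.[ℂ] E) :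
    unitaryConj S.symm (unitaryConj S T) = T := by
  refine LinearPMap.eq_of_eq_graph ?_
  ext ⟨u, v⟩
  simp only [mem_graph_unitaryConj, LinearIsometryEquiv.symm_symm,
    LinearIsometryEquiv.symm_apply_apply]

theorem unitaryConj_closure {S : E ≃ₗᵢ[ℂ] E} {T T' : E →ₗ.[ℂ] E} (h : unitaryConj S T = T')
    (hT : T.IsClosable) (hT' : T'.IsClosable) : unitaryConj S T.closure = T'.closure := by
  have hset : (T'.graph : Set (E × E)) =
      (S.symm.toHomeomorph.prodCongr S.symm.toHomeomorph) ⁻¹' (T.graph : Set (E × E)) := by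
    ext ⟨u, v⟩
    rw [← h]
    exact mem_graph_unitaryConj S T u v
  refine LinearPMap.eq_of_eq_graph ?_
  ext ⟨u, v⟩
  rw [mem_graph_unitaryConj, ← hT.graph_closure_eq_closure_graph,
    ← hT'.graph_closure_eq_closure_graph, ← SetLike.mem_coe, ← SetLike.mem_coe,
    Submodule.topologicalClosure_coe, Submodule.topologicalClosure_coe, hset,
    ← Homeomorph.preimage_closure]
  rfl

theorem mem_opSpectrum_iff (T : E →ₗ.[ℂ] E) (z : ℂ) :
    z ∈ opSpectrum T ↔ ¬ ∃ R : E →L[ℂ] E, (∀ f, (R f, f + z • R f) ∈ T.graph) ∧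
      ∀ u v, (u, v) ∈ T.graph → R (v - z • u) = u := by
  refine not_congr (exists_congr fun R => and_congr_right fun _ => ⟨fun h u v huv => ?_,
    fun h x => h _ _ (T.mem_graph x)⟩)
  obtain ⟨x, rfl, rfl⟩ := (LinearPMap.mem_graph_iff T).1 huv
  exact h x

theorem opSpectrum_unitaryConj_subset (S : E ≃ₗᵢ[ℂ] E) (T : E →ₗ.[ℂ] E) :
    opSpectrum (unitaryConj S T) ⊆ opSpectrum T := by
  intro z hz
  rw [mem_opSpectrum_iff] at hz ⊢
  rintro ⟨R, h1, h2⟩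
  -- the resolvent is conjugated as well
  refine hz ⟨(S : E →L[ℂ] E) ∘L R ∘L (S.symm : E →L[ℂ] E), fun f => ?_, fun u v huv => ?_⟩
  · rw [mem_graph_unitaryConj]
    simpa using h1 (S.symm f)
  · rw [mem_graph_unitaryConj] at huv
    have h3 := h2 _ _ huv
    rw [← map_smul, ← map_sub] at h3
    exact (congrArg S h3).trans (S.apply_symm_apply u)

theorem opSpectrum_unitaryConj (S : E ≃ₗᵢ[ℂ] E) (T : E →ₗ.[ℂ] E) :
    opSpectrum (unitaryConj S T) = opSpectrum T := by
  refine (opSpectrum_unitaryConj_subset S T).antisymm ?_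
  have h := opSpectrum_unitaryConj_subset S.symm (unitaryConj S T)
  rwa [unitaryConj_symm_unitaryConj] at h

end Unitary

/-- The phase of a Hermite function under `exp (-i (π/2) (a*a + b*b))`. -/
def phase (i : ℕ × ℕ) : ℂ := (-Complex.I) ^ (i.1 + i.2)

theorem conj_phase_mul_phase (i : ℕ × ℕ) : starRingEnd ℂ (phase i) * phase i = 1 := by
  rw [phase, map_pow, ← mul_pow]
  simp

theorem phase_ne_zero (i : ℕ × ℕ) : phase i ≠ 0 :=
  right_ne_zero_of_mul_eq_one (conj_phase_mul_phase i)

theorem orthonormal_phase_smul_hermite :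
    Orthonormal ℂ fun i => phase i • toL2 (hermite i) := by
  have h := orthonormal_iff_ite.1 orthonormal_hermite
  rw [orthonormal_iff_ite]
  intro i j
  rw [inner_smul_left, inner_smul_right, h i j]
  by_cases hij : i = j
  · subst hij
    simp [conj_phase_mul_phase]
  · simp [hij]

/-- The rotated Hermite basis. -/
def rotatedBasis : HilbertBasis (ℕ × ℕ) ℂ L2 :=
  HilbertBasis.mk orthonormal_phase_smul_hermite (by
    rw [← topologicalClosure_gaussPoly, map_gaussPoly_eq_span]
    refine Submodule.topologicalClosure_mono (Submodule.span_le.2 ?_)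
    rintro _ ⟨i, rfl⟩
    have h := Submodule.smul_mem (Submodule.span ℂ (Set.range fun i => phase i • toL2 (hermite i)))
      (phase i)⁻¹ (Submodule.subset_span ⟨i, rfl⟩)
    simpa [smul_smul, phase_ne_zero] using h)

/-- The unitary operator `exp (-i (π/2) (a*a + b*b))`, diagonal in the Hermite basis. -/
def quarterTurn : L2 ≃ₗᵢ[ℂ] L2 := hermiteBasis.repr.trans rotatedBasis.repr.symm

theorem quarterTurn_hermite (i : ℕ × ℕ) :
    quarterTurn (toL2 (hermite i)) = phase i • toL2 (hermite i) := by
  rw [quarterTurn, LinearIsometryEquiv.trans_apply, ← hermiteBasis_apply, HilbertBasis.repr_self,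
    HilbertBasis.repr_symm_single, hermiteBasis_apply]
  exact congrFun (HilbertBasis.coe_mk _ _) i

/-- Conjugation with the unitary operator is determined by the action on the Hermite functions. -/
theorem unitaryConj_quarterTurn {T T' : Op}
    (h : ∀ i, quarterTurn (toL2 (T (hermite i))) = phase i • toL2 (T' (hermite i))) :
    unitaryConj quarterTurn (onGaussPoly T) = onGaussPoly T' := by
  have hto : ∀ f ∈ gaussPoly, ∃ g ∈ gaussPoly, quarterTurn (toL2 f) = toL2 g ∧
      quarterTurn (toL2 (T f)) = toL2 (T' g) := by
    intro f hf
    rw [gaussPoly_eq_span_hermite] at hf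
    induction hf using Submodule.span_induction with
    | mem f hf =>
      obtain ⟨i, rfl⟩ := hf
      exact ⟨phase i • hermite i, Submodule.smul_mem _ _ (hermite_mem i),
        by rw [quarterTurn_hermite, map_smul], by rw [h, map_smul, map_smul]⟩
    | zero => exact ⟨0, Submodule.zero_mem _, by simp, by simp⟩
    | add f k _ _ hf hk =>
      obtain ⟨g, h1, h2, h3⟩ := hf
      obtain ⟨l, h4, h5, h6⟩ := hk
      exact ⟨g + l, Submodule.add_mem _ h1 h4, by simp only [map_add, h2, h5],
        by simp only [map_add, h3, h6]⟩
    | smul c f _ hf =>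
      obtain ⟨g, h1, h2, h3⟩ := hf
      exact ⟨c • g, Submodule.smul_mem _ _ h1, by simp only [map_smul, h2],
        by simp only [map_smul, h3]⟩
  have hfrom : ∀ g ∈ gaussPoly, ∃ f ∈ gaussPoly, quarterTurn (toL2 f) = toL2 g := by
    intro g hg
    rw [gaussPoly_eq_span_hermite] at hg
    induction hg using Submodule.span_induction with
    | mem g hg =>
      obtain ⟨i, rfl⟩ := hg
      refine ⟨(phase i)⁻¹ • hermite i, Submodule.smul_mem _ _ (hermite_mem i), ?_⟩
      rw [map_smul, map_smul, quarterTurn_hermite, smul_smul, inv_mul_cancel₀ (phase_ne_zero i),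
        one_smul]
    | zero => exact ⟨0, Submodule.zero_mem _, by simp⟩
    | add g k _ _ hg hk =>
      obtain ⟨f, h1, h2⟩ := hg
      obtain ⟨l, h4, h5⟩ := hk
      exact ⟨f + l, Submodule.add_mem _ h1 h4, by simp only [map_add, h2, h5]⟩
    | smul c g _ hg =>
      obtain ⟨f, h1, h2⟩ := hg
      exact ⟨c • f, Submodule.smul_mem _ _ h1, by simp only [map_smul, h2]⟩
  refine LinearPMap.eq_of_eq_graph ?_
  ext ⟨u, v⟩
  rw [mem_graph_unitaryConj, mem_graph_onGaussPoly, mem_graph_onGaussPoly]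
  constructor
  · rintro ⟨f, hf, h1, h2⟩
    obtain ⟨g, hg, h3, h4⟩ := hto f hf
    exact ⟨g, hg, by rw [← h3, h1, LinearIsometryEquiv.apply_symm_apply],
      by rw [← h4, h2, LinearIsometryEquiv.apply_symm_apply]⟩
  · rintro ⟨g, hg, rfl, rfl⟩
    obtain ⟨f, hf, h1⟩ := hfrom g hg
    obtain ⟨k, hk, h3, h4⟩ := hto f hf
    have h5 : k = g := toL2_injective (h3.symm.trans h1)
    subst h5
    exact ⟨f, hf, by rw [← h3, LinearIsometryEquiv.symm_apply_apply],
      by rw [← h4, LinearIsometryEquiv.symm_apply_apply]⟩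

theorem phase_eq_I_mul (m n : ℕ) : phase (m, n) = Complex.I * phase (m + 1, n) := by
  simp only [phase]
  rw [show m + 1 + n = (m + n) + 1 by ring, pow_succ]
  linear_combination (-Complex.I) ^ (m + n) * Complex.I_mul_I

theorem phase_eq_I_mul' (m n : ℕ) : phase (m, n) = Complex.I * phase (m, n + 1) := by
  simp only [phase]
  rw [← add_assoc, pow_succ]
  linear_combination (-Complex.I) ^ (m + n) * Complex.I_mul_I

theorem onGaussPoly_smul (z : ℂ) (T : Op) : onGaussPoly (z • T) = z • onGaussPoly T := by
  refine LinearPMap.ext rfl fun x hx hx' => ?_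
  exact map_smul toL2 z _

theorem unitaryConj_opA :
    unitaryConj quarterTurn (onGaussPoly opA) = Complex.I • onGaussPoly opA := by
  rw [← onGaussPoly_smul]
  refine unitaryConj_quarterTurn ?_
  rintro ⟨_ | m, n⟩
  · simp [opA_hermite]
  · rw [LinearMap.smul_apply, opA_hermite, Nat.add_sub_cancel]
    simp only [map_smul, quarterTurn_hermite, smul_smul, phase_eq_I_mul m n]
    congr 1
    ring

theorem unitaryConj_opB :
    unitaryConj quarterTurn (onGaussPoly opB) = Complex.I • onGaussPoly opB := by
  rw [← onGaussPoly_smul]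
  refine unitaryConj_quarterTurn ?_
  rintro ⟨m, _ | n⟩
  · simp [opB_hermite]
  · rw [LinearMap.smul_apply, opB_hermite, Nat.add_sub_cancel]
    simp only [map_smul, quarterTurn_hermite, smul_smul, phase_eq_I_mul' m n]
    congr 1
    ring

theorem phase_succ_succ (m n : ℕ) : phase (m + 1, n + 1) = -phase (m, n) := by
  rw [phase_eq_I_mul m n, phase_eq_I_mul' (m + 1) n]
  linear_combination phase (m + 1, n + 1) * Complex.I_mul_I

theorem unitaryConj_onGaussPoly_hamOp (β γ : ℝ) :
    unitaryConj quarterTurn (onGaussPoly (hamOp β γ)) = onGaussPoly (hamOp β (-γ)) := by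
  refine unitaryConj_quarterTurn ?_
  rintro ⟨m, n⟩
  rw [hamOp_hermite, hamOp_hermite]
  rcases m with _ | m
  · simp only [map_add, map_sub, map_smul, quarterTurn_hermite, phase_succ_succ]
    simp only [Nat.cast_zero, Real.sqrt_zero, Complex.ofReal_zero, zero_mul, zero_smul]
    push_cast
    module
  · rcases n with _ | n
    · simp only [map_add, map_sub, map_smul, quarterTurn_hermite, phase_succ_succ]
      simp only [Nat.cast_zero, Real.sqrt_zero, Complex.ofReal_zero, mul_zero, zero_smul]
      push_cast
      module
    · simp only [map_add, map_sub, map_smul, quarterTurn_hermite, phase_succ_succ,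
        Nat.add_sub_cancel]
      push_cast
      module

theorem adjoint_ham_eq_unitaryConj (β γ : ℝ) :
    (ham β γ).adjoint = unitaryConj quarterTurn (ham β γ) := by
  rw [adjoint_ham]
  exact (unitaryConj_closure (unitaryConj_onGaussPoly_hamOp β γ) (isClosable_hamOp β γ)
    (isClosable_hamOp β (-γ))).symm

theorem exp_mul_natCast (k : ℕ) :
    Complex.exp (-Complex.I * (Real.pi / 2) * k) = (-Complex.I) ^ k := by
  rw [mul_comm, Complex.exp_nat_mul]
  congr 1
  rw [show -Complex.I * (Real.pi / 2 : ℂ) = -(Real.pi / 2 * Complex.I) by ring, Complex.exp_neg,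
    Complex.exp_pi_div_two_mul_I, Complex.inv_I]

theorem isExp_quarterTurn :
    IsExp (-Complex.I * (Real.pi / 2)) (opAs * opA + opBs * opB) quarterTurn := by
  intro f hf
  rw [gaussPoly_eq_span_hermite] at hf
  induction hf using Submodule.span_induction with
  | mem f hf =>
    obtain ⟨⟨m, n⟩, rfl⟩ := hf
    have h1 : (opAs * opA + opBs * opB) (hermite (m, n)) = ((m + n : ℕ) : ℂ) • hermite (m, n) := by
      rw [hermite, map_smul, LinearMap.add_apply, Module.End.mul_apply, Module.End.mul_apply,
        isTwoMode_bosons.number_fst_fock opA_vacuum, isTwoMode_bosons.number_snd_fock opB_vacuum]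
      push_cast
      module
    have h2 : ∀ k : ℕ, ((opAs * opA + opBs * opB) ^ k) (hermite (m, n)) =
        ((m + n : ℕ) : ℂ) ^ k • hermite (m, n) := by
      intro k
      induction k with
      | zero => simp
      | succ k ih =>
        rw [pow_succ', Module.End.mul_apply, ih, map_smul, h1, smul_smul, pow_succ]
    have h3 : HasSum (fun k : ℕ =>
        (-Complex.I * (Real.pi / 2) * ((m + n : ℕ) : ℂ)) ^ k / (k.factorial : ℂ))
        (phase (m, n)) := by
      rw [phase, ← exp_mul_natCast, Complex.exp_eq_exp_ℂ]
      exact NormedSpace.expSeries_div_hasSum_exp _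
    rw [quarterTurn_hermite]
    convert h3.smul_const (toL2 (hermite (m, n))) using 2 with k
    rw [h2, map_smul, smul_smul, mul_pow _ ((m + n : ℕ) : ℂ), div_mul_eq_mul_div]
  | zero => simp
  | add f g _ _ hf hg =>
    simpa only [map_add, smul_add] using hf.add hg
  | smul c f _ hf =>
    simpa only [map_smul, smul_comm c] using hf.const_smul c

/-! ### The class of the Hamiltonian -/

theorem fock_bosons_ne_zero (i : ℕ × ℕ) : fock opAs opBs vacuum i ≠ 0 := by
  rw [fock_eq_smul_hermite]
  refine smul_ne_zero (fockNorm_ne_zero i) fun h => orthonormal_hermite.ne_zero i ?_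
  rw [h, map_zero]

theorem opAs_vacuum_ne_zero : opAs vacuum ≠ 0 := by
  simpa [fock] using fock_bosons_ne_zero (1, 0)

theorem opBs_vacuum_ne_zero : opBs vacuum ≠ 0 := by
  simpa [fock] using fock_bosons_ne_zero (0, 1)

theorem abs_lt_one_add_rho (γ : ℝ) : |γ| < 1 + rho γ := by
  have : |γ| ≤ rho γ := Real.abs_le_sqrt (by linarith)
  linarith

theorem normConst_mul_ne {γ : ℝ} (hγ : γ ≠ 0) :
    normConst γ * ((1 + rho γ : ℝ) : ℂ) ≠ star (normConst γ) * (γ : ℂ) := by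
  intro h
  have h1 := congrArg norm h
  have h2 := one_le_rho γ
  rw [norm_mul, norm_mul, norm_star, Complex.norm_real, Complex.norm_real, Real.norm_eq_abs,
    Real.norm_eq_abs, abs_of_pos (by linarith)] at h1
  have h3 := mul_left_cancel₀ (norm_ne_zero_iff.2 (normConst_ne_zero hγ)) h1
  exact (abs_lt_one_add_rho γ).ne' h3

theorem opCd_ne_opCs {γ : ℝ} (hγ : γ ≠ 0) : opCd γ ≠ opCs γ := by
  intro h
  have h1 := congrArg (fun T : Op => T vacuum) h
  simp only [opCd, opCs, LinearMap.smul_apply, LinearMap.sub_apply, LinearMap.add_apply,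
    opB_vacuum, smul_zero, sub_zero, zero_add, smul_smul] at h1
  exact normConst_mul_ne hγ (smul_left_injective ℂ opAs_vacuum_ne_zero h1)

theorem opDd_ne_opDs {γ : ℝ} (hγ : γ ≠ 0) : opDd γ ≠ opDs γ := by
  intro h
  have h1 := congrArg (fun T : Op => T vacuum) h
  simp only [opDd, opDs, LinearMap.smul_apply, LinearMap.sub_apply, LinearMap.add_apply,
    opA_vacuum, smul_zero, sub_zero, zero_add, smul_smul] at h1
  exact normConst_mul_ne hγ (smul_left_injective ℂ opBs_vacuum_ne_zero h1)

/-- The Hamiltonian and its adjoint differ on the vacuum, by the pair creation term. -/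
theorem not_isSelfAdjoint_ham (β : ℝ) {γ : ℝ} (hγ : γ ≠ 0) : ¬ IsSelfAdjoint (ham β γ) := by
  intro h
  rw [LinearPMap.isSelfAdjoint_def, adjoint_ham] at h
  have h1 := toL2_mem_graph_ham β γ (hermite (0, 0))
  have h2 := toL2_mem_graph_ham β (-γ) (hermite (0, 0))
  rw [h] at h2
  have h3 := toL2_injective (LinearPMap.mem_graph_snd_inj (ham β γ) h1 h2 rfl)
  rw [hamOp_hermite, hamOp_hermite] at h3
  simp only [Nat.cast_zero, Real.sqrt_zero, Complex.ofReal_zero, mul_zero, zero_smul, sub_zero,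
    add_right_inj, zero_add, Nat.cast_one, Real.sqrt_one, Complex.ofReal_one, mul_one,
    one_smul] at h3
  have h4 : hermite (1, 1) ≠ 0 := fun h5 => orthonormal_hermite.ne_zero (1, 1) (by simp [h5])
  have h5 := smul_left_injective ℂ h4 h3
  have h6 : γ = -γ := by exact_mod_cast h5
  exact hγ (by linarith)

theorem not_bounded_ham (β : ℝ) {γ : ℝ} (hγ : γ ≠ 0) :
    ¬ ∃ C : ℝ, ∀ f : (ham β γ).domain, ‖ham β γ f‖ ≤ C * ‖(f : L2)‖ := by
  rintro ⟨C, hC⟩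
  obtain ⟨m, hm⟩ := exists_nat_gt C
  -- the eigenvalues on the diagonal tend to infinity
  have h1 := (isEigenvector_psi β hγ (m, m)).2
  obtain ⟨x, h2, h3⟩ := (LinearPMap.mem_graph_iff _).1 h1
  have h4 := hC x
  have h5 := norm_pos_iff.2 (psi_ne_zero hγ (m, m))
  have h6 := one_le_rho γ
  have h7 : energy β γ (m, m) = rho γ * (1 + 2 * m) := by
    simp only [energy]
    ring
  have h8 : (m : ℝ) ≤ energy β γ (m, m) := by
    rw [h7]
    have : (0 : ℝ) ≤ m := Nat.cast_nonneg m
    nlinarith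
  rw [h3, h2, norm_smul, Complex.norm_real] at h4
  have h9 := le_of_mul_le_mul_right h4 h5
  have h10 := Real.le_norm_self (energy β γ (m, m))
  linarith

theorem classC_ham (β : ℝ) {γ : ℝ} (hγ : γ ≠ 0) : ClassC (ham β γ) where
  dense_domain := dense_domain_ham β γ
  closed := (isClosable_hamOp β γ).closure_isClosed
  unbounded := not_bounded_ham β hγ
  not_selfAdjoint := not_isSelfAdjoint_ham β hγ
  eigenvalues_nonempty := by
    rw [eigenvalues_ham β hγ]
    exact Set.range_nonempty _
  eigenvalues_real := by
    rw [eigenvalues_ham β hγ]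
    rintro _ ⟨i, rfl⟩
    exact Complex.ofReal_im _
  eigenvalues_adjoint := by rw [eigenvalues_ham β hγ, eigenvalues_adjoint_ham β hγ]
  spectrum_adjoint := by rw [adjoint_ham_eq_unitaryConj, opSpectrum_unitaryConj]
  biorthogonal := ⟨ℕ × ℕ, energy β γ, psi γ, psi' γ, isEigenvector_psi β hγ,
    isEigenvector_psi' β hγ, isCompleteSystem_psi hγ, isCompleteSystem_psi' hγ,
    inner_psi_psi'_eq_zero_iff hγ⟩
  unitarily_equivalent := ⟨quarterTurn, adjoint_ham_eq_unitaryConj β γ⟩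

end PseudoBoson

end

theorem mainTheorem3 (β γ : ℝ) (hγ : γ ≠ 0) :
    -- `H` is the closure of a densely defined closable operator
    Dense ((onGaussPoly (hamOp β γ)).domain : Set L2) ∧
    (onGaussPoly (hamOp β γ)).IsClosable ∧
    -- `H` belongs to the class
    ClassC (ham β γ) ∧
    -- adjoints of the bosonic and pseudo-bosonic operators
    (IsFormalAdjoint opA opAs ∧ IsFormalAdjoint opB opBs ∧
      IsFormalAdjoint (opC γ) (opCs γ) ∧ IsFormalAdjoint (opD γ) (opDs γ) ∧
      IsFormalAdjoint (opCd γ) (opCds γ) ∧ IsFormalAdjoint (opDd γ) (opDds γ)) ∧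
    -- canonical commutation relations of the bosons
    (⁅opA, opAs⁆ = 1 ∧ ⁅opB, opBs⁆ = 1 ∧ ⁅opA, opBs⁆ = 0 ∧ ⁅opB, opAs⁆ = 0 ∧
      ⁅opAs, opBs⁆ = 0 ∧ ⁅opA, opB⁆ = 0) ∧
    -- `c, c^‡, d, d^‡` are pseudo-bosons
    (⁅opC γ, opCd γ⁆ = 1 ∧ ⁅opD γ, opDd γ⁆ = 1 ∧ ⁅opC γ, opDd γ⁆ = 0 ∧ ⁅opD γ, opCd γ⁆ = 0 ∧
      ⁅opCd γ, opDd γ⁆ = 0 ∧ ⁅opC γ, opD γ⁆ = 0 ∧ opCd γ ≠ opCs γ ∧ opDd γ ≠ opDs γ) ∧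
    hamOp β γ = (β : ℂ) • (opCd γ * opC γ - opDd γ * opD γ)
      + (rho γ : ℂ) • (opCd γ * opC γ + opD γ * opDd γ) ∧
    -- the vacua of the pseudo-bosons
    (HasSum (fun k : ℕ => ((-alpha γ : ℂ) ^ k / (k.factorial : ℂ)) •
        toL2 (((opAs * opBs) ^ k) vacuum)) (toL2 (psiZero γ)) ∧
      HasSum (fun k : ℕ => ((alpha γ : ℂ) ^ k / (k.factorial : ℂ)) •
        toL2 (((opAs * opBs) ^ k) vacuum)) (toL2 (psiZero' γ)) ∧
      opC γ (psiZero γ) = 0 ∧ opD γ (psiZero γ) = 0 ∧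
      opCds γ (psiZero' γ) = 0 ∧ opDds γ (psiZero' γ) = 0) ∧
    -- eigenvalues and eigenvectors of `H`
    (eigenvalues (ham β γ) = Set.range (fun i : ℕ × ℕ => (energy β γ i : ℂ)) ∧
      (∀ i, IsEigenvector (ham β γ) (energy β γ i) (psi γ i)) ∧ IsCompleteSystem (psi γ)) ∧
    -- eigenvalues and eigenvectors of `H*`
    (eigenvalues (ham β γ).adjoint = Set.range (fun i : ℕ × ℕ => (energy β γ i : ℂ)) ∧
      (∀ i, IsEigenvector (ham β γ).adjoint (energy β γ i) (psi' γ i)) ∧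
      IsCompleteSystem (psi' γ)) ∧
    -- biorthogonality
    (inner ℂ (toL2 (psiZero γ)) (toL2 (psiZero' γ)) ≠ 0 ∧
      ∀ m n p q : ℕ, inner ℂ (psi γ (m, n)) (psi' γ (p, q)) =
        if m = p ∧ n = q then
          ((m.factorial * n.factorial : ℕ) : ℂ) * inner ℂ (toL2 (psiZero γ)) (toL2 (psiZero' γ))
        else 0) ∧
    -- the unitary `S = exp (-i (π/2) (a*a + b*b))` takes `H` into its adjoint
    ∃ S : L2 ≃ₗᵢ[ℂ] L2,
      IsExp (-Complex.I * (Real.pi / 2)) (opAs * opA + opBs * opB) S ∧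
      unitaryConj S (onGaussPoly opA) = Complex.I • onGaussPoly opA ∧
      unitaryConj S (onGaussPoly opB) = Complex.I • onGaussPoly opB ∧
      (ham β γ).adjoint = unitaryConj S (ham β γ) := by
  have hb := isTwoMode_bosons
  have hp := isTwoMode_pseudoBosons hγ
  refine ⟨dense_domain_onGaussPoly _, isClosable_hamOp β γ, classC_ham β hγ,
    ⟨isFormalAdjoint_opA, isFormalAdjoint_opB, isFormalAdjoint_opC γ, isFormalAdjoint_opD γ,
      isFormalAdjoint_opCd γ, isFormalAdjoint_opDd γ⟩,
    ⟨hb.comm_a, hb.comm_b, hb.comm_ab', hb.comm_ba', hb.comm_raise,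
      by rw [Ring.lie_def, opA_opB, sub_self]⟩,
    ⟨hp.comm_a, hp.comm_b, hp.comm_ab', hp.comm_ba', hp.comm_raise,
      by rw [Ring.lie_def, opC_opD, sub_self], opCd_ne_opCs hγ, opDd_ne_opDs hγ⟩,
    hamOp_eq β hγ,
    ⟨hasSum_squeezed _ _, ?_, opC_psiZero γ, opD_psiZero γ, opCds_psiZero' γ, opDds_psiZero' γ⟩,
    ⟨eigenvalues_ham β hγ, isEigenvector_psi β hγ, isCompleteSystem_psi hγ⟩,
    ⟨eigenvalues_adjoint_ham β hγ, isEigenvector_psi' β hγ, isCompleteSystem_psi' hγ⟩,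
    ⟨inner_psiZero_ne_zero hγ, inner_psi_psi' hγ⟩,
    quarterTurn, isExp_quarterTurn, unitaryConj_opA, unitaryConj_opB,
    adjoint_ham_eq_unitaryConj β γ⟩
  have h := hasSum_squeezed (-alpha γ) (by rw [abs_neg]; exact abs_alpha_lt_one γ)
  simp only [Complex.ofReal_neg, neg_neg] at h
  exact h
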